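/- Let $Sk_6$ be the space of skew-symmetric complex $6\times 6$ matrices. Consider holomorphic map germs $M:(\mathbb C^s,0)\to(Sk_6,0)$. The rank of $M$ is the rank of its derivative at $0$. Two germs $M_1,M_2$ are $Sk$-equivalent if $M_1\circ\varphi=A^\top M_2A$ for some germ of a biholomorphism $\varphi:(\mathbb C^s,0)\to(\mathbb C^s,0)$ and some germ at $0$ of a holomorphic map $A:\mathbb C^s\to GL_6(\mathbb C)$; two $k$-jets are equivalent if they lie in the same orbit of the induced action on $k$-jets. The germ $M$ is $Sk_6$-simple if, for every $k$, some neighbourhood of its $k$-jet in the space of $k$-jets of germs $(\mathbb C^s,0)\to(Sk_6,0)$ meets only finitely many orbits. (1) If $s>13$, then no germ $M:(\mathbb C^s,0)\to(Sk_6,0)$ of rank $13$ is $Sk_6$-simple. More precisely, already every neighbourhood of the $2$-jet of $M$ meets infinitely many orbits of $2$-jets. (2) The eigenvalues of a pair of quadratic forms are moduli. Let $$L_a(x)=\begin{pmatrix} 0 & x_{12} & x_{13} & -x_{36} & x_{15} & x_{16} \\ -x_{12} & 0 & x_{23} & x_{24} & -x_{36} & x_{26} \\ -x_{13} & -x_{23}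 & 0 & x_{34} & x_{35} & x_{36} \\ x_{36} & -x_{24} & -x_{34} & 0 & x_{45} & x_{46} \\ -x_{15} & x_{36} & -x_{35} & -x_{45} & 0 & x_{56} \\ -x_{16} & -x_{26} & -x_{36} & -x_{46} & -x_{56} & 0 \end{pmatrix}$$ and let $\mathcal E_{ij}=E_{ij}-E_{ji}$, where $E_{ij}$ are the matrix units. For $m\ge 0$ and $\alpha\in\mathbb C^m$ put $$N_\alpha(x,z)=L_a(x)+\Big(\sum_{l=1}^m z_l^2\Big)\mathcal E_{14}+\Big(\sum_{l=1}^m \alpha_l z_l^2\Big)\mathcal E_{25},$$ a germ on $\mathbb C^{13}_x\times\mathbb C^m_z$. Then $N_\alpha$ has rank $13$, and for every $\alpha\in\mathbb C^m$ there are only finitely many $\beta\in\mathbb C^m$ such that the $2$-jets of $N_\alpha$ and $N_\beta$ are equivalent. -/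

import Mathlib

open Filter Topology Matrix

/-- A (representative of a) holomorphic map germ `(ℂ^s, 0) → (Sk_n, 0)`, where `Sk_n` is the space
of skew-symmetric complex `n × n` matrices. Only the values near the origin matter. -/
structure SkGerm (s n : ℕ) where
  toFun : (Fin s → ℂ) → Matrix (Fin n) (Fin n) ℂ
  analytic : ∀ i j, AnalyticAt ℂ (fun x => toFun x i j) 0
  skew : ∀ᶠ x in 𝓝 (0 : Fin s → ℂ), (toFun x)ᵀ = -toFun x
  map_zero : toFun 0 = 0

/-- `φ` represents a germ of a biholomorphism `(ℂ^s, 0) → (ℂ^s, 0)`. -/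
def IsBiholGerm {s : ℕ} (φ : (Fin s → ℂ) → (Fin s → ℂ)) : Prop :=
  AnalyticAt ℂ φ 0 ∧ φ 0 = 0 ∧
    ∃ ψ : (Fin s → ℂ) → (Fin s → ℂ), AnalyticAt ℂ ψ 0 ∧ ψ 0 = 0 ∧
      (∀ᶠ x in 𝓝 (0 : Fin s → ℂ), ψ (φ x) = x) ∧ (∀ᶠ x in 𝓝 (0 : Fin s → ℂ), φ (ψ x) = x)

/-- `A` represents a germ at the origin of a holomorphic map to `GL_n(ℂ)`. -/
def IsGLGerm {s n : ℕ} (A : (Fin s → ℂ) → Matrix (Fin n) (Fin n) ℂ) : Prop :=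
  (∀ i j, AnalyticAt ℂ (fun x => A x i j) 0) ∧ IsUnit (A 0)

namespace SkGerm

variable {s n : ℕ}

/-- `Sk`-equivalence of germs: `M₁ ∘ φ = Aᵀ M₂ A` near the origin. -/
def Equivalent (M₁ M₂ : SkGerm s n) : Prop :=
  ∃ (φ : (Fin s → ℂ) → (Fin s → ℂ)) (A : (Fin s → ℂ) → Matrix (Fin n) (Fin n) ℂ),
    IsBiholGerm φ ∧ IsGLGerm A ∧
      ∀ᶠ x in 𝓝 (0 : Fin s → ℂ), M₁.toFun (φ x) = (A x)ᵀ * M₂.toFun x * A x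

/-- The derivative of the germ at the origin, as a linear map into the space of matrices. -/
noncomputable def differential (M : SkGerm s n) :
    (Fin s → ℂ) →ₗ[ℂ] Matrix (Fin n) (Fin n) ℂ where
  toFun v := Matrix.of fun i j => fderiv ℂ (fun x => M.toFun x i j) 0 v
  map_add' v w := by ext i j; simp
  map_smul' c v := by ext i j; simp

/-- The rank of the germ: the rank of its derivative at the origin. -/
noncomputable def rank (M : SkGerm s n) : ℕ := Module.finrank ℂ (LinearMap.range M.differential)

/-- The `k`-jet at the origin: all derivatives of order at most `k` of all the entries. It lies in
a finite-dimensional complex vector space, which carries its usual topology. -/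
noncomputable def jet (k : ℕ) (M : SkGerm s n) (i j : Fin n) (l : Fin (k + 1)) :
    ContinuousMultilinearMap ℂ (fun _ : Fin (l : ℕ) => Fin s → ℂ) ℂ :=
  iteratedFDeriv ℂ (l : ℕ) (fun x => M.toFun x i j) 0

/-- The `k`-jets of `M` and `N` lie in the same orbit of `Sk`-equivalence acting on `k`-jets. -/
def JetEquivalent (k : ℕ) (M N : SkGerm s n) : Prop :=
  ∃ M' : SkGerm s n, Equivalent M M' ∧ M'.jet k = N.jet k

/-- Some neighbourhood of the `k`-jet of `M`, in the space of `k`-jets of germs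
`(ℂ^s, 0) → (Sk_n, 0)`, meets only finitely many orbits. -/
def IsJetSimple (k : ℕ) (M : SkGerm s n) : Prop :=
  ∃ U ∈ 𝓝 (M.jet k), ∃ T : Set (SkGerm s n), T.Finite ∧
    ∀ N : SkGerm s n, N.jet k ∈ U → ∃ P ∈ T, JetEquivalent k N P

/-- `Sk_n`-simplicity: no moduli among the nearby germs which vanish at the origin, that is, which
have the same matrix corank `n`. (Finiteness for `k`-jets implies finiteness for `l`-jets with
`l ≤ k`, so that `for all k` is the same as `for all sufficiently large k`.) -/
def IsSimple (M : SkGerm s n) : Prop := ∀ k : ℕ, IsJetSimple k M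

end SkGerm

/-- The matrix `L_a(x) + p 𝓔₁₄ + q 𝓔₂₅`, where `𝓔_ij = E_ij - E_ji` and the thirteen coordinates
are `x₁₂, x₁₃, x₁₅, x₁₆, x₂₃, x₂₄, x₂₆, x₃₄, x₃₅, x₃₆, x₄₅, x₄₆, x₅₆` in this order. -/
def genericRank13Matrix (x : Fin 13 → ℂ) (p q : ℂ) : Matrix (Fin 6) (Fin 6) ℂ :=
  !![0, x 0, x 1, -x 9 + p, x 2, x 3;
     -x 0, 0, x 4, x 5, -x 9 + q, x 6;
     -x 1, -x 4, 0, x 7, x 8, x 9;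
     x 9 - p, -x 5, -x 7, 0, x 10, x 11;
     -x 2, x 9 - q, -x 8, -x 10, 0, x 12;
     -x 3, -x 6, -x 9, -x 11, -x 12, 0]

/-- The germ `L_a(x) + (∑ z_i²) 𝓔₁₄ + (∑ a_i z_i²) 𝓔₂₅` on `ℂ^13 × ℂ^m`; the `a_i` are the
eigenvalues of the pair of quadratic forms. -/
noncomputable def quadraticPairGerm {m : ℕ} (a : Fin m → ℂ) : SkGerm (13 + m) 6 where
  toFun w := genericRank13Matrix (fun k => w (Fin.castAdd m k))
    (∑ i, w (Fin.natAdd 13 i) ^ 2) (∑ i, a i * w (Fin.natAdd 13 i) ^ 2)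
  analytic i j := by
    have h : ∀ k : Fin (13 + m), AnalyticAt ℂ (fun w : Fin (13 + m) → ℂ => w k) 0 := fun k =>
      (ContinuousLinearMap.proj (R := ℂ) (φ := fun _ : Fin (13 + m) => ℂ) k).analyticAt 0
    have hp : AnalyticAt ℂ (fun w : Fin (13 + m) → ℂ => ∑ i : Fin m, w (Fin.natAdd 13 i) ^ 2) 0 :=
      Finset.analyticAt_fun_sum _ fun i _ => (h _).pow 2
    have hq : AnalyticAt ℂ
        (fun w : Fin (13 + m) → ℂ => ∑ i : Fin m, a i * w (Fin.natAdd 13 i) ^ 2) 0 :=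
      Finset.analyticAt_fun_sum _ fun i _ => analyticAt_const.mul ((h _).pow 2)
    fin_cases i <;> fin_cases j <;> simp [genericRank13Matrix] <;>
      first
        | exact analyticAt_const
        | exact h _
        | exact (h _).neg
        | exact (h _).neg.add hp
        | exact (h _).neg.add hq
        | exact (h _).sub hp
        | exact (h _).sub hq
  skew := Eventually.of_forall fun w => by
    ext i j
    fin_cases i <;> fin_cases j <;> simp [genericRank13Matrix] <;> ring
  map_zero := by
    ext i j
    fin_cases i <;> fin_cases j <;> simp [genericRank13Matrix]

/-! The obstruction is a cross-ratio. Under the trace pairing, the skew matrices orthogonal to the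
image of `dM(0)` form a space of dimension 15 - 13 = 2, a pencil. It carries two kinds of
distinguished lines. The Pfaffian restricts to a binary cubic, so a generic pencil has three
singular lines. Moreover, for `Y` in the pencil the function `⟨Y, M⟩` is critical at 0, so its
Hessian restricted to `ker dM(0)` is intrinsic, and the lines where this form degenerates are the
eigenvalues of a pencil of quadratic forms. An equivalence acts on the pencil by `Y ↦ A Y Aᵀ` and on
the kernel linearly, so the cross-ratios of three singular lines with a degenerate one depend only
on the orbit of the 2-jet (`JetEquivalent.crossRatios_eq`). They form a finite set as soon as the
pencil contains one invertible matrix and one nondegenerate form (`crossRatios_finite`).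

For part (1), a small perturbation makes the Pfaffian cubic have distinct roots
(`exists_generic_annihilator`) and some Hessian nondegenerate. Since `s > 13` the kernel is nonzero,
so a degenerate line exists over `ℂ`. Adding a small multiple of `⟨B, M⟩ X`, with `X` dual to a
basis of the pencil, leaves the singular lines fixed and translates the degenerate ones
(`isDegenerateAt_perturb_component`). A cross-ratio thus sweeps out a neighbourhood in `ℂ`, while
finitely many orbits supply only finitely many values.

For part (2), the Pfaffian on the pencil of `N_α` is `-pq(p + q)` and the Hessian is diagonal with
entries proportional to `p + α_l q`. Hence each nonzero `α_l` has its inverse among the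
cross-ratios, and an orbit determines every `α_l` up to finitely many choices. -/

/-! ### Second derivatives of scalar analytic functions. -/

section SecondDerivative

variable {E F : Type*} [NormedAddCommGroup E] [NormedSpace ℂ E] [NormedAddCommGroup F]
  [NormedSpace ℂ F]

theorem fderiv_fderiv_add {f g : E → ℂ} {x : E} (hf : AnalyticAt ℂ f x) (hg : AnalyticAt ℂ g x) :
    fderiv ℂ (fderiv ℂ fun y => f y + g y) x =
      fderiv ℂ (fderiv ℂ f) x + fderiv ℂ (fderiv ℂ g) x := by
  have h : fderiv ℂ (fun y => f y + g y) =ᶠ[𝓝 x] fun y => fderiv ℂ f y + fderiv ℂ g y := by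
    filter_upwards [hf.eventually_analyticAt, hg.eventually_analyticAt] with y h1 h2
    exact fderiv_fun_add h1.differentiableAt h2.differentiableAt
  rw [h.fderiv_eq, fderiv_fun_add hf.fderiv.differentiableAt hg.fderiv.differentiableAt]

theorem fderiv_fderiv_mul_apply {f g : E → ℂ} {x : E} (hf : AnalyticAt ℂ f x)
    (hg : AnalyticAt ℂ g x) (v w : E) :
    fderiv ℂ (fderiv ℂ fun y => f y * g y) x v w =
      f x * fderiv ℂ (fderiv ℂ g) x v w + fderiv ℂ f x v * fderiv ℂ g x w +
        (g x * fderiv ℂ (fderiv ℂ f) x v w + fderiv ℂ g x v * fderiv ℂ f x w) := by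
  have h : fderiv ℂ (fun y => f y * g y) =ᶠ[𝓝 x]
      fun y => f y • fderiv ℂ g y + g y • fderiv ℂ f y := by
    filter_upwards [hf.eventually_analyticAt, hg.eventually_analyticAt] with y h1 h2
    exact fderiv_fun_mul h1.differentiableAt h2.differentiableAt
  have hf' := hf.differentiableAt
  have hg' := hg.differentiableAt
  have hf'' := hf.fderiv.differentiableAt
  have hg'' := hg.fderiv.differentiableAt
  rw [h.fderiv_eq, fderiv_fun_add (hf'.fun_smul hg'') (hg'.fun_smul hf''), fderiv_fun_smul hf' hg'',
    fderiv_fun_smul hg' hf'']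
  simp

/-- At a critical point the term containing the second derivative of `φ` drops out. This is why
Hessians of critical functions transform as bilinear forms. -/
theorem fderiv_fderiv_comp_apply [CompleteSpace F] {g : F → ℂ} {φ : E → F} {x : E} (hg : AnalyticAt ℂ g (φ x))
    (hφ : AnalyticAt ℂ φ x) (hd : fderiv ℂ g (φ x) = 0) (v w : E) :
    fderiv ℂ (fderiv ℂ fun y => g (φ y)) x v w =
      fderiv ℂ (fderiv ℂ g) (φ x) (fderiv ℂ φ x v) (fderiv ℂ φ x w) := by
  have h : fderiv ℂ (fun y => g (φ y)) =ᶠ[𝓝 x]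
      fun y => (fderiv ℂ g (φ y)).comp (fderiv ℂ φ y) := by
    filter_upwards [hφ.continuousAt.eventually hg.eventually_analyticAt,
      hφ.eventually_analyticAt] with y h1 h2
    exact fderiv_fun_comp y h1.differentiableAt h2.differentiableAt
  have h1 : HasFDerivAt (fun y => fderiv ℂ g (φ y))
      ((fderiv ℂ (fderiv ℂ g) (φ x)).comp (fderiv ℂ φ x)) x :=
    hg.fderiv.differentiableAt.hasFDerivAt.comp x hφ.differentiableAt.hasFDerivAt
  rw [h.fderiv_eq, (h1.clm_comp hφ.fderiv.differentiableAt.hasFDerivAt).fderiv]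
  simp [hd]

theorem fderiv_fderiv_const_mul {f : E → ℂ} {x : E} (hf : AnalyticAt ℂ f x) (c : ℂ) :
    fderiv ℂ (fderiv ℂ fun y => c * f y) x = c • fderiv ℂ (fderiv ℂ f) x := by
  ext v w
  simp [fderiv_fderiv_mul_apply analyticAt_const hf]

theorem fderiv_fderiv_sum {ι : Type*} (t : Finset ι) {f : ι → E → ℂ} {x : E}
    (hf : ∀ i ∈ t, AnalyticAt ℂ (f i) x) :
    fderiv ℂ (fderiv ℂ fun y => ∑ i ∈ t, f i y) x = ∑ i ∈ t, fderiv ℂ (fderiv ℂ (f i)) x := by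
  classical
  induction t using Finset.induction_on with
  | empty => simp
  | insert a t ha ih =>
    simp only [Finset.sum_insert ha]
    rw [fderiv_fderiv_add (hf a (by simp)) (Finset.analyticAt_fun_sum _ fun i hi => hf i (by simp [hi])),
      ih fun i hi => hf i (by simp [hi])]

end SecondDerivative

/-! ### The trace pairing and congruence. -/

/-- The trace pairing `∑ Y_ij X_ij` of two square matrices. -/
noncomputable def tracePairing (n : ℕ) : LinearMap.BilinForm ℂ (Matrix (Fin n) (Fin n) ℂ) :=
  LinearMap.mk₂ ℂ (fun Y X => (Yᵀ * X).trace) (fun _ _ _ => by simp [add_mul])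
    (fun _ _ _ => by simp) (fun _ _ _ => by simp [mul_add]) (fun _ _ _ => by simp)

section tracePairing

variable {n : ℕ}

theorem tracePairing_eq_trace (Y X : Matrix (Fin n) (Fin n) ℂ) :
    tracePairing n Y X = (Yᵀ * X).trace := rfl

theorem tracePairing_apply (Y X : Matrix (Fin n) (Fin n) ℂ) :
    tracePairing n Y X = ∑ i, ∑ j, Y i j * X i j := by
  rw [tracePairing_eq_trace, Finset.sum_comm]
  simp [Matrix.trace, Matrix.mul_apply]

/-- Cyclicity of the trace: the adjoint of a congruence is the congruence by the transpose. -/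
theorem tracePairing_congruence (A Y X : Matrix (Fin n) (Fin n) ℂ) :
    tracePairing n Y (Aᵀ * X * A) = tracePairing n (A * Y * Aᵀ) X := by
  simp only [tracePairing_eq_trace, Matrix.transpose_mul, Matrix.transpose_transpose]
  rw [← Matrix.trace_mul_cycle]
  simp only [Matrix.mul_assoc]

end tracePairing

/-! ### Cross-ratios as invariants of 2-jets. -/

namespace SkGerm

variable {s n : ℕ}

/-- The second derivative of the germ at the origin. -/
noncomputable def second (M : SkGerm s n) :
    (Fin s → ℂ) →ₗ[ℂ] (Fin s → ℂ) →ₗ[ℂ] Matrix (Fin n) (Fin n) ℂ :=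
  LinearMap.mk₂ ℂ
    (fun v w => Matrix.of fun i j => fderiv ℂ (fderiv ℂ fun x => M.toFun x i j) 0 v w)
    (fun _ _ _ => by ext; simp) (fun _ _ _ => by ext; simp) (fun _ _ _ => by ext; simp)
    (fun _ _ _ => by ext; simp)

theorem differential_apply (M : SkGerm s n) (v : Fin s → ℂ) (i j : Fin n) :
    M.differential v i j = fderiv ℂ (fun x => M.toFun x i j) 0 v := rfl

theorem second_apply (M : SkGerm s n) (v w : Fin s → ℂ) (i j : Fin n) :
    M.second v w i j = fderiv ℂ (fderiv ℂ fun x => M.toFun x i j) 0 v w := rfl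

/-- The component of the second derivative in the direction of the matrix `Y`. -/
noncomputable def hess (M : SkGerm s n) (Y : Matrix (Fin n) (Fin n) ℂ) :
    LinearMap.BilinForm ℂ (Fin s → ℂ) :=
  M.second.compr₂ (tracePairing n Y)

theorem hess_apply (M : SkGerm s n) (Y : Matrix (Fin n) (Fin n) ℂ) (v w : Fin s → ℂ) :
    M.hess Y v w = tracePairing n Y (M.second v w) := rfl

theorem hess_add (M : SkGerm s n) (Y Z : Matrix (Fin n) (Fin n) ℂ) :
    M.hess (Y + Z) = M.hess Y + M.hess Z := by
  ext; simp [hess_apply]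

theorem hess_smul (M : SkGerm s n) (c : ℂ) (Y : Matrix (Fin n) (Fin n) ℂ) :
    M.hess (c • Y) = c • M.hess Y := by
  ext; simp [hess_apply]

/-- The skew-symmetric matrices orthogonal to the range of the differential. -/
noncomputable def annihilator (M : SkGerm s n) : Submodule ℂ (Matrix (Fin n) (Fin n) ℂ) where
  carrier := {Y | Yᵀ = -Y ∧ ∀ v, tracePairing n Y (M.differential v) = 0}
  add_mem' {a b} ha hb := ⟨by simp [ha.1, hb.1, add_comm], fun v => by simp [ha.2 v, hb.2 v]⟩
  zero_mem' := by simp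
  smul_mem' c a ha := ⟨by simp [ha.1], fun v => by simp [ha.2 v]⟩

theorem mem_annihilator {M : SkGerm s n} {Y : Matrix (Fin n) (Fin n) ℂ} :
    Y ∈ M.annihilator ↔ Yᵀ = -Y ∧ ∀ v, tracePairing n Y (M.differential v) = 0 := Iff.rfl

/-- The form `hess Y` degenerates on the kernel of the differential. -/
def IsDegenerateAt (M : SkGerm s n) (Y : Matrix (Fin n) (Fin n) ℂ) : Prop :=
  ∃ v, M.differential v = 0 ∧ v ≠ 0 ∧ ∀ w, M.differential w = 0 → M.hess Y v w = 0

/-- The cross-ratios of three singular lines and one degenerate line of the annihilator. -/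
def crossRatios (M : SkGerm s n) : Set ℂ :=
  {c | ∃ Y ∈ M.annihilator, ∃ Z ∈ M.annihilator, LinearIndependent ℂ ![Y, Z] ∧
    Y.det = 0 ∧ Z.det = 0 ∧ (Y + Z).det = 0 ∧ M.IsDegenerateAt (Y + c • Z)}

/-- The relation induced by equivalence of `2`-jets on the differentials and on the second
derivatives modulo the range of the differential. -/
def LinearlyEquivalent (M N : SkGerm s n) : Prop :=
  ∃ (e : (Fin s → ℂ) ≃ₗ[ℂ] (Fin s → ℂ)) (A : Matrix (Fin n) (Fin n) ℂ), IsUnit A.det ∧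
    (∀ v, M.differential (e v) = Aᵀ * N.differential v * A) ∧
    ∀ Y ∈ M.annihilator, ∀ v w, N.differential v = 0 → N.differential w = 0 →
      M.hess Y (e v) (e w) = N.hess (A * Y * Aᵀ) v w

theorem annihilator_congruence {M N : SkGerm s n} {e : (Fin s → ℂ) ≃ₗ[ℂ] (Fin s → ℂ)}
    {A : Matrix (Fin n) (Fin n) ℂ} (h : ∀ v, M.differential (e v) = Aᵀ * N.differential v * A)
    {Y : Matrix (Fin n) (Fin n) ℂ} (hY : Y ∈ M.annihilator) : A * Y * Aᵀ ∈ N.annihilator := by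
  refine ⟨by simp [hY.1, Matrix.mul_assoc], fun v => ?_⟩
  rw [← tracePairing_congruence, ← h, hY.2]

theorem LinearlyEquivalent.symm {M N : SkGerm s n} (h : LinearlyEquivalent M N) :
    LinearlyEquivalent N M := by
  obtain ⟨e, A, hA, h1, h2⟩ := h
  have hA1 : A⁻¹ * A = 1 := Matrix.nonsing_inv_mul A hA
  have hA2 : A * A⁻¹ = 1 := Matrix.mul_nonsing_inv A hA
  have hT1 : A⁻¹ᵀ * Aᵀ = 1 := by rw [← Matrix.transpose_mul, hA2, Matrix.transpose_one]
  have hT2 : Aᵀ * A⁻¹ᵀ = 1 := by rw [← Matrix.transpose_mul, hA1, Matrix.transpose_one]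
  have key : ∀ v, N.differential (e.symm v) = A⁻¹ᵀ * M.differential v * A⁻¹ := fun v => by
    have := h1 (e.symm v)
    rw [e.apply_symm_apply] at this
    rw [this]
    calc N.differential (e.symm v) = (A⁻¹ᵀ * Aᵀ) * N.differential (e.symm v) * (A * A⁻¹) := by
          rw [hT1, hA2, one_mul, mul_one]
      _ = _ := by simp only [Matrix.mul_assoc]
  refine ⟨e.symm, A⁻¹, by simpa using Matrix.isUnit_nonsing_inv_det A hA, key, ?_⟩
  intro Y hY v w hv hw
  have := h2 _ (annihilator_congruence key hY) (e.symm v) (e.symm w) (by simp [key, hv])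
    (by simp [key, hw])
  rw [e.apply_symm_apply, e.apply_symm_apply] at this
  have h3 : Y = A * (A⁻¹ * Y * A⁻¹ᵀ) * Aᵀ := by
    calc Y = (A * A⁻¹) * Y * (A⁻¹ᵀ * Aᵀ) := by rw [hT1, hA2, one_mul, mul_one]
      _ = _ := by simp only [Matrix.mul_assoc]
  rw [this, ← h3]

/-- The map `Y ↦ A Y Aᵀ` is linear and injective and preserves singularity, while `e` matches the
kernels of the two differentials. The coefficient `c` is therefore unchanged. -/
theorem LinearlyEquivalent.crossRatios_subset {M N : SkGerm s n} (h : LinearlyEquivalent M N) :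
    M.crossRatios ⊆ N.crossRatios := by
  obtain ⟨e, A, hA, h1, h2⟩ := h
  have hT : IsUnit Aᵀ.det := by rwa [Matrix.det_transpose]
  rintro c ⟨Y, hY, Z, hZ, hli, dY, dZ, dYZ, v, hv, hv0, hvw⟩
  refine ⟨_, annihilator_congruence h1 hY, _, annihilator_congruence h1 hZ, ?_, by simp [dY],
    by simp [dZ], by rw [← add_mul, ← mul_add]; simp [dYZ], ?_⟩
  · rw [LinearIndependent.pair_iff] at hli ⊢
    intro a b hab
    apply hli
    have : A * (a • Y + b • Z) * Aᵀ = 0 := by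
      rw [← hab]; simp [mul_add, add_mul]
    have hu := (Matrix.isUnit_iff_isUnit_det A).2 hA
    rwa [((Matrix.isUnit_iff_isUnit_det _).2 hT).mul_left_eq_zero, hu.mul_right_eq_zero] at this
  · have hk : ∀ w, N.differential w = 0 ↔ M.differential (e w) = 0 := fun w => by
      refine ⟨fun hw => by simp [h1, hw], fun hw => ?_⟩
      rwa [h1, ((Matrix.isUnit_iff_isUnit_det A).2 hA).mul_left_eq_zero,
        ((Matrix.isUnit_iff_isUnit_det _).2 hT).mul_right_eq_zero] at hw
    refine ⟨e.symm v, by simp [hk, hv], by simpa using hv0, fun w hw => ?_⟩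
    have := h2 _ (add_mem hY (M.annihilator.smul_mem c hZ)) (e.symm v) w (by simp [hk, hv]) hw
    rw [e.apply_symm_apply, hvw _ ((hk w).1 hw)] at this
    rw [this]
    simp [mul_add, add_mul]

theorem LinearlyEquivalent.crossRatios_eq {M N : SkGerm s n} (h : LinearlyEquivalent M N) :
    M.crossRatios = N.crossRatios :=
  h.crossRatios_subset.antisymm h.symm.crossRatios_subset

theorem differential_eq_of_jet_eq {M N : SkGerm s n} (h : M.jet 2 = N.jet 2) :
    M.differential = N.differential := by
  refine LinearMap.ext fun v => ?_
  ext i j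
  have := DFunLike.congr_fun (congrFun (congrFun (congrFun h i) j) 1) (fun _ => v : Fin 1 → Fin s → ℂ)
  simp only [jet] at this
  erw [iteratedFDeriv_one_apply, iteratedFDeriv_one_apply] at this
  exact this

theorem second_eq_of_jet_eq {M N : SkGerm s n} (h : M.jet 2 = N.jet 2) :
    M.second = N.second := by
  refine LinearMap.ext₂ fun v w => ?_
  ext i j
  have := DFunLike.congr_fun (congrFun (congrFun (congrFun h i) j) 2) ![v, w]
  simp only [jet] at this
  erw [iteratedFDeriv_two_apply, iteratedFDeriv_two_apply] at this
  exact this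

/-- The component of the germ in the direction of the matrix `Y`. -/
noncomputable def component (M : SkGerm s n) (Y : Matrix (Fin n) (Fin n) ℂ) (x : Fin s → ℂ) : ℂ :=
  tracePairing n Y (M.toFun x)

theorem component_eq (M : SkGerm s n) (Y : Matrix (Fin n) (Fin n) ℂ) :
    M.component Y = fun x => ∑ i, ∑ j, Y i j * M.toFun x i j := by
  ext x; exact tracePairing_apply _ _

theorem analyticAt_component (M : SkGerm s n) (Y : Matrix (Fin n) (Fin n) ℂ) :
    AnalyticAt ℂ (M.component Y) 0 := by
  rw [component_eq]
  exact Finset.analyticAt_fun_sum _ fun i _ => Finset.analyticAt_fun_sum _ fun j _ =>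
    analyticAt_const.mul (M.analytic i j)

theorem fderiv_component (M : SkGerm s n) (Y : Matrix (Fin n) (Fin n) ℂ) (v : Fin s → ℂ) :
    fderiv ℂ (M.component Y) 0 v = tracePairing n Y (M.differential v) := by
  have h : ∀ i j, DifferentiableAt ℂ (fun x => M.toFun x i j) 0 := fun i j =>
    (M.analytic i j).differentiableAt
  have h' : ∀ i j, DifferentiableAt ℂ (fun x => Y i j * M.toFun x i j) 0 := fun i j =>
    (h i j).const_mul _
  rw [component_eq, tracePairing_apply, fderiv_fun_sum fun i _ =>
    DifferentiableAt.fun_sum fun j _ => h' i j]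
  rw [_root_.sum_apply]
  refine Finset.sum_congr rfl fun i _ => ?_
  rw [fderiv_fun_sum fun j _ => h' i j, _root_.sum_apply]
  refine Finset.sum_congr rfl fun j _ => ?_
  rw [fderiv_const_mul (h i j)]
  rfl

theorem fderiv_fderiv_component (M : SkGerm s n) (Y : Matrix (Fin n) (Fin n) ℂ)
    (v w : Fin s → ℂ) : fderiv ℂ (fderiv ℂ (M.component Y)) 0 v w = M.hess Y v w := by
  have h : ∀ i j, AnalyticAt ℂ (fun x => Y i j * M.toFun x i j) 0 := fun i j =>
    analyticAt_const.mul (M.analytic i j)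
  rw [component_eq, hess_apply, tracePairing_apply, fderiv_fderiv_sum _ fun i _ =>
    Finset.analyticAt_fun_sum _ fun j _ => h i j]
  rw [_root_.sum_apply, _root_.sum_apply]
  refine Finset.sum_congr rfl fun i _ => ?_
  rw [fderiv_fderiv_sum _ fun j _ => h i j,
    _root_.sum_apply, _root_.sum_apply]
  refine Finset.sum_congr rfl fun j _ => ?_
  rw [fderiv_fderiv_const_mul (M.analytic i j)]
  rfl

theorem fderiv_component_eq_zero {M : SkGerm s n} {Y : Matrix (Fin n) (Fin n) ℂ}
    (hY : Y ∈ M.annihilator) : fderiv ℂ (M.component Y) 0 = 0 := by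
  ext v
  rw [fderiv_component, hY.2 v, _root_.zero_apply]

/-- Near 0, `⟨Y, M ∘ φ⟩ = ⟨A Y Aᵀ, N⟩` with `A` depending on `x`. Because `N` vanishes at 0, its
first derivative sees only `A 0`. In the second derivative the mixed terms contain `dN(v)` or
`dN(w)` and vanish on the kernel; on the other side the second derivative of `φ` is multiplied by
the differential of `⟨Y, M⟩`, which is zero for `Y` in the annihilator. -/
theorem Equivalent.linearlyEquivalent {M N : SkGerm s n} (h : Equivalent M N) :
    LinearlyEquivalent M N := by
  obtain ⟨φ, A, ⟨hφ, hφ0, ψ, hψ, hψ0, hψφ, hφψ⟩, ⟨hA, hA0⟩, heq⟩ := h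
  have hφd := hφ.differentiableAt.hasFDerivAt
  have hψd := hψ.differentiableAt.hasFDerivAt
  have inv : ∀ {f g : (Fin s → ℂ) → (Fin s → ℂ)}, f 0 = 0 → g 0 = 0 →
      DifferentiableAt ℂ f 0 → DifferentiableAt ℂ g 0 → (∀ᶠ x in 𝓝 0, g (f x) = x) →
      ∀ v, fderiv ℂ g 0 (fderiv ℂ f 0 v) = v := by
    intro f g hf0 hg0 hf hg hgf v
    have h1 : fderiv ℂ (fun x => g (f x)) 0 = ContinuousLinearMap.id ℂ _ := by
      have : (fun x => g (f x)) =ᶠ[𝓝 0] id := hgf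
      rw [this.fderiv_eq, fderiv_id]
    rw [fderiv_fun_comp 0 (by rwa [hf0]) hf, hf0] at h1
    exact DFunLike.congr_fun h1 v
  let e : (Fin s → ℂ) ≃ₗ[ℂ] (Fin s → ℂ) := LinearEquiv.ofLinearMap
    (fderiv ℂ φ 0).toLinearMap (fderiv ℂ ψ 0).toLinearMap
    (LinearMap.ext fun v => inv hψ0 hφ0 hψ.differentiableAt hφ.differentiableAt hφψ v)
    (LinearMap.ext fun v => inv hφ0 hψ0 hφ.differentiableAt hψ.differentiableAt hψφ v)
  have he : ∀ v, e v = fderiv ℂ φ 0 v := fun _ => rfl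
  have hN0 : ∀ k l, N.toFun 0 k l = 0 := fun k l => by rw [N.map_zero]; rfl
  set c : Matrix (Fin n) (Fin n) ℂ → Fin n → Fin n → (Fin s → ℂ) → ℂ :=
    fun Y k l x => (A x * Y * (A x)ᵀ) k l with hc
  have hcA : ∀ Y k l, AnalyticAt ℂ (c Y k l) 0 := fun Y k l => by
    simp only [hc, Matrix.mul_apply, Matrix.transpose_apply]
    exact Finset.analyticAt_fun_sum _ fun i _ => (Finset.analyticAt_fun_sum _ fun j _ =>
      (hA _ _).mul analyticAt_const).mul (hA _ _)
  have hcomp : ∀ Y, (fun x => M.component Y (φ x)) =ᶠ[𝓝 0]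
      fun x => ∑ k, ∑ l, c Y k l x * N.toFun x k l := fun Y => by
    filter_upwards [heq] with x hx
    rw [component, hx, tracePairing_congruence, tracePairing_apply]
  have hterm : ∀ Y k l, AnalyticAt ℂ (fun x => c Y k l x * N.toFun x k l) 0 := fun Y k l =>
    (hcA Y k l).mul (N.analytic k l)
  have hM : ∀ Y, AnalyticAt ℂ (M.component Y) (φ 0) := fun Y => by
    rw [hφ0]; exact M.analyticAt_component Y
  have hfirst : ∀ Y v, tracePairing n Y (M.differential (e v)) =
      tracePairing n (A 0 * Y * (A 0)ᵀ) (N.differential v) := fun Y v => by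
    have h1 : fderiv ℂ (fun x => M.component Y (φ x)) 0 v =
        tracePairing n Y (M.differential (e v)) := by
      rw [fderiv_fun_comp 0 (hM Y).differentiableAt hφ.differentiableAt, hφ0,
        ContinuousLinearMap.comp_apply, fderiv_component, he]
    rw [← h1, (hcomp Y).fderiv_eq, fderiv_fun_sum fun k _ => DifferentiableAt.fun_sum fun l _ =>
      (hterm Y k l).differentiableAt, _root_.sum_apply, tracePairing_apply]
    refine Finset.sum_congr rfl fun k _ => ?_
    rw [fderiv_fun_sum fun l _ => (hterm Y k l).differentiableAt, _root_.sum_apply]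
    refine Finset.sum_congr rfl fun l _ => ?_
    rw [fderiv_fun_mul (hcA Y k l).differentiableAt (N.analytic k l).differentiableAt]
    simp [hN0, hc, differential_apply]
  refine ⟨e, A 0, (Matrix.isUnit_iff_isUnit_det _).1 hA0, fun v => ?_, ?_⟩
  · ext i j
    -- At first order `Y` is arbitrary, so matrix units read off the entries.
    have h1 := hfirst (Matrix.single i j 1) v
    rw [← tracePairing_congruence, tracePairing_apply, tracePairing_apply] at h1
    simpa [Matrix.single_apply, ite_and] using h1
  · intro Y hY v w hv hw
    have hd : fderiv ℂ (M.component Y) (φ 0) = 0 := by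
      rw [hφ0]; exact fderiv_component_eq_zero hY
    have h1 := fderiv_fderiv_comp_apply (hM Y) hφ hd v w
    rw [hφ0, fderiv_fderiv_component, ← he, ← he, (hcomp Y).fderiv.fderiv_eq,
      fderiv_fderiv_sum _ fun k _ => Finset.analyticAt_fun_sum _ fun l _ => hterm Y k l] at h1
    rw [← h1, _root_.sum_apply, _root_.sum_apply, hess_apply,
      tracePairing_apply]
    refine Finset.sum_congr rfl fun k _ => ?_
    rw [fderiv_fderiv_sum _ fun l _ => hterm Y k l, _root_.sum_apply,
      _root_.sum_apply]
    refine Finset.sum_congr rfl fun l _ => ?_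
    have hv' : fderiv ℂ (fun x => N.toFun x k l) 0 v = 0 := by
      rw [← differential_apply, hv]; rfl
    have hw' : fderiv ℂ (fun x => N.toFun x k l) 0 w = 0 := by
      rw [← differential_apply, hw]; rfl
    rw [fderiv_fderiv_mul_apply (hcA Y k l) (N.analytic k l), hN0, hv', hw']
    simp [hc, second_apply]

theorem JetEquivalent.crossRatios_eq {M N : SkGerm s n} (h : JetEquivalent 2 M N) :
    M.crossRatios = N.crossRatios := by
  obtain ⟨M', h1, h2⟩ := h
  rw [h1.linearlyEquivalent.crossRatios_eq]
  simp only [crossRatios, IsDegenerateAt, hess, annihilator, differential_eq_of_jet_eq h2,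
    second_eq_of_jet_eq h2]

end SkGerm

/-! ### Linear pencils, finite unions of lines, and cross-ratios. -/

section Pencil

variable {V W E : Type*} [AddCommGroup V] [Module ℂ V] [AddCommGroup W] [Module ℂ W]
  [AddCommGroup E] [Module ℂ E]

/-- With `T = g⁻¹ f`, the singular members of the pencil `f + c g` become eigenvalues. Both the
finiteness and the existence of singular members follow from this. -/
theorem pencil_kernel_iff {f g : V →ₗ[ℂ] W} {T : Module.End ℂ V} (hg : Function.Injective g)
    (hT : ∀ v, g (T v) = f v) (c : ℂ) :
    (∃ v ≠ 0, f v + c • g v = 0) ↔ T.HasEigenvalue (-c) := by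
  have key : ∀ v, f v + c • g v = 0 ↔ T v = (-c) • v := fun v => by
    rw [← hT, ← map_smul, ← map_add, map_eq_zero_iff g hg, neg_smul, add_eq_zero_iff_eq_neg]
  constructor
  · rintro ⟨v, hv, h⟩
    exact Module.End.hasEigenvalue_of_hasEigenvector
      ⟨Module.End.mem_eigenspace_iff.2 ((key v).1 h), hv⟩
  · intro h
    obtain ⟨v, hv⟩ := h.exists_hasEigenvector
    exact ⟨v, hv.2, (key v).2 (Module.End.mem_eigenspace_iff.1 hv.1)⟩

theorem exists_intertwiner [FiniteDimensional ℂ V] [FiniteDimensional ℂ W] (f : V →ₗ[ℂ] W)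
    {g : V →ₗ[ℂ] W} (hVW : Module.finrank ℂ V = Module.finrank ℂ W) (hg : Function.Injective g) :
    ∃ T : Module.End ℂ V, ∀ v, g (T v) = f v := by
  let e := LinearEquiv.ofBijective g
    ⟨hg, (LinearMap.injective_iff_surjective_of_finrank_eq_finrank hVW).1 hg⟩
  exact ⟨e.symm.toLinearMap ∘ₗ f, fun v => e.apply_symm_apply (f v)⟩

theorem finite_singular_pencil [FiniteDimensional ℂ V] [FiniteDimensional ℂ W] (f : V →ₗ[ℂ] W)
    {g : V →ₗ[ℂ] W} (hVW : Module.finrank ℂ V = Module.finrank ℂ W) (hg : Function.Injective g) :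
    {c : ℂ | ∃ v ≠ 0, f v + c • g v = 0}.Finite := by
  obtain ⟨T, hT⟩ := exists_intertwiner f hVW hg
  simp only [pencil_kernel_iff hg hT]
  exact (T.finite_hasEigenvalue).preimage neg_injective.injOn

theorem exists_singular_pencil [FiniteDimensional ℂ V] [FiniteDimensional ℂ W] [Nontrivial V]
    (f : V →ₗ[ℂ] W) {g : V →ₗ[ℂ] W} (hVW : Module.finrank ℂ V = Module.finrank ℂ W)
    (hg : Function.Injective g) : ∃ c : ℂ, ∃ v ≠ 0, f v + c • g v = 0 := by
  obtain ⟨T, hT⟩ := exists_intertwiner f hVW hg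
  obtain ⟨c, hc⟩ := Module.End.exists_eigenvalue T
  exact ⟨-c, (pencil_kernel_iff hg hT _).2 (by rwa [neg_neg])⟩

theorem finite_det_add_smul_eq_zero {n : ℕ} (A : Matrix (Fin n) (Fin n) ℂ)
    {B : Matrix (Fin n) (Fin n) ℂ} (hB : B.det ≠ 0) : {c : ℂ | (A + c • B).det = 0}.Finite := by
  have hg : Function.Injective B.mulVecLin :=
    Matrix.mulVec_injective_iff_isUnit.2 ((Matrix.isUnit_iff_isUnit_det B).2 hB.isUnit)
  refine (finite_singular_pencil A.mulVecLin rfl hg).subset fun c hc => ?_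
  obtain ⟨v, hv, h⟩ := Matrix.exists_mulVec_eq_zero_iff.2 hc
  exact ⟨v, hv, by simpa [Matrix.add_mulVec, Matrix.smul_mulVec] using h⟩

/-- A set of vectors that lies in a finite union of lines. -/
def CoveredByLines (S : Set E) : Prop :=
  ∃ R : Set E, R.Finite ∧ ∀ y ∈ S, ∃ r ∈ R, ∃ k : ℂ, y = k • r

/-- Projectively the plane is the affine line `A + c B` together with the point `B`. The set is a
cone that misses `B`, so only finitely many affine points remain. -/
theorem coveredByLines_of_pencil {S : Set E} {A B : E}
    (hV : ∀ y ∈ S, y ∈ Submodule.span ℂ {A, B}) (hS : ∀ y ∈ S, ∀ k : ℂ, k ≠ 0 → k • y ∈ S)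
    (hB : B ∉ S) (hf : {c : ℂ | A + c • B ∈ S}.Finite) : CoveredByLines S := by
  refine ⟨insert 0 ((fun c : ℂ => A + c • B) '' {c : ℂ | A + c • B ∈ S}), (hf.image _).insert _,
    fun y hy => ?_⟩
  obtain ⟨a, b, rfl⟩ := Submodule.mem_span_pair.1 (hV y hy)
  by_cases ha : a = 0
  · subst ha
    by_cases hb : b = 0
    · exact ⟨0, by simp, 0, by simp [hb]⟩
    · refine (hB ?_).elim
      have := hS _ hy b⁻¹ (inv_ne_zero hb)
      rwa [zero_smul, zero_add, smul_smul, inv_mul_cancel₀ hb, one_smul] at this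
  · have h : a⁻¹ • (a • A + b • B) = A + (a⁻¹ * b) • B := by
      rw [smul_add, smul_smul, smul_smul, inv_mul_cancel₀ ha, one_smul]
    refine ⟨_, Or.inr ⟨a⁻¹ * b, ?_, rfl⟩, a, ?_⟩
    · rw [Set.mem_ofPred_eq, ← h]
      exact hS _ hy _ (inv_ne_zero ha)
    · simp only [← h]
      rw [smul_smul, mul_inv_cancel₀ ha, one_smul]

theorem exists_smul_of_collinear {y z r : E} {k l : ℂ} (hy : y ≠ 0) (h1 : y = k • r)
    (h2 : z = l • r) : ∃ a : ℂ, z = a • y := by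
  have hk : k ≠ 0 := by rintro rfl; simp [h1] at hy
  exact ⟨l * k⁻¹, by rw [h1, h2, smul_smul, mul_assoc, inv_mul_cancel₀ hk, mul_one]⟩

/-- Three distinct lines in a plane fix the basis up to one common scalar: `y' = a y` and `z' = b
z`, and the third line forces `a = b`. The fourth line then has only one coordinate `c`. -/
theorem crossRatio_unique {y z y' z' r₁ r₂ r₃ r₄ : E} {c c' : ℂ}
    (h : LinearIndependent ℂ ![y, z]) (h' : LinearIndependent ℂ ![y', z'])
    (h₁ : ∃ k : ℂ, y = k • r₁) (h₂ : ∃ k : ℂ, z = k • r₂) (h₃ : ∃ k : ℂ, y + z = k • r₃)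
    (h₄ : ∃ k : ℂ, y + c • z = k • r₄) (h₁' : ∃ k : ℂ, y' = k • r₁) (h₂' : ∃ k : ℂ, z' = k • r₂)
    (h₃' : ∃ k : ℂ, y' + z' = k • r₃) (h₄' : ∃ k : ℂ, y' + c' • z' = k • r₄) : c = c' := by
  have hy : y ≠ 0 := h.ne_zero 0
  have hz : z ≠ 0 := h.ne_zero 1
  have hy' : y' ≠ 0 := h'.ne_zero 0
  rw [LinearIndependent.pair_iff] at h
  have hadd : ∀ d : ℂ, y + d • z ≠ 0 := fun d hd => one_ne_zero (h 1 d (by simpa using hd)).1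
  obtain ⟨k₁, h₁⟩ := h₁
  obtain ⟨k₂, h₂⟩ := h₂
  obtain ⟨k₃, h₃⟩ := h₃
  obtain ⟨k₄, h₄⟩ := h₄
  obtain ⟨l₁, h₁'⟩ := h₁'
  obtain ⟨l₂, h₂'⟩ := h₂'
  obtain ⟨l₃, h₃'⟩ := h₃'
  obtain ⟨l₄, h₄'⟩ := h₄'
  obtain ⟨a, rfl⟩ := exists_smul_of_collinear hy h₁ h₁'
  obtain ⟨b, rfl⟩ := exists_smul_of_collinear hz h₂ h₂'
  obtain ⟨k, hk⟩ := exists_smul_of_collinear (by simpa using hadd 1) h₃ h₃'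
  obtain ⟨l, hl⟩ := exists_smul_of_collinear (hadd c) h₄ h₄'
  have e1 := h (a - k) (b - k) (by linear_combination (norm := module) hk)
  have e2 := h (a - l) (c' * b - l * c) (by
    rw [sub_smul, sub_smul, mul_smul, mul_smul]
    rw [smul_add] at hl
    linear_combination (norm := module) hl)
  have ha : a ≠ 0 := by rintro rfl; simp at hy'
  have hb : b = a := by linear_combination e1.2 - e1.1
  subst hb
  have : b * (c - c') = 0 := by linear_combination -e2.2 + c * e2.1
  exact sub_eq_zero.1 ((mul_eq_zero.1 this).resolve_left ha)

theorem finite_crossRatios {S T : Set E} (hS : CoveredByLines S) (hT : CoveredByLines T) :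
    {c : ℂ | ∃ y ∈ S, ∃ z ∈ S, LinearIndependent ℂ ![y, z] ∧ y + z ∈ S ∧ y + c • z ∈ T}.Finite := by
  obtain ⟨R, hR, hSR⟩ := hS
  obtain ⟨Q, hQ, hTQ⟩ := hT
  refine ((hR.prod (hR.prod (hR.prod hQ))).biUnion (t := fun r : E × E × E × E =>
    {c : ℂ | ∃ y z : E, LinearIndependent ℂ ![y, z] ∧ (∃ k : ℂ, y = k • r.1) ∧
      (∃ k : ℂ, z = k • r.2.1) ∧ (∃ k : ℂ, y + z = k • r.2.2.1) ∧
      (∃ k : ℂ, y + c • z = k • r.2.2.2)}) fun r _ => ?_).subset ?_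
  · apply Set.Subsingleton.finite
    rintro c ⟨y, z, h, h1, h2, h3, h4⟩ c' ⟨y', z', h', h1', h2', h3', h4'⟩
    exact crossRatio_unique h h' h1 h2 h3 h4 h1' h2' h3' h4'
  · rintro c ⟨y, hy, z, hz, hli, hyz, hc⟩
    obtain ⟨r1, m1, h1⟩ := hSR y hy
    obtain ⟨r2, m2, h2⟩ := hSR z hz
    obtain ⟨r3, m3, h3⟩ := hSR _ hyz
    obtain ⟨r4, m4, h4⟩ := hTQ _ hc
    exact Set.mem_biUnion (x := (r1, r2, r3, r4)) ⟨m1, m2, m3, m4⟩ ⟨y, z, hli, h1, h2, h3, h4⟩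

end Pencil

/-! ### Finiteness of the set of cross-ratios. -/

namespace SkGerm

variable {s n : ℕ}

/-- The form `hess Y` restricted to the kernel of the differential. -/
noncomputable def kernelForm (M : SkGerm s n) (Y : Matrix (Fin n) (Fin n) ℂ) :
    LinearMap.ker M.differential →ₗ[ℂ] Module.Dual ℂ (LinearMap.ker M.differential) :=
  (M.hess Y).domRestrict₁₂ _ _

theorem kernelForm_apply (M : SkGerm s n) (Y : Matrix (Fin n) (Fin n) ℂ)
    (v w : LinearMap.ker M.differential) : M.kernelForm Y v w = M.hess Y v w := rfl

theorem isDegenerateAt_iff {M : SkGerm s n} {Y : Matrix (Fin n) (Fin n) ℂ} :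
    M.IsDegenerateAt Y ↔ ∃ v ≠ 0, M.kernelForm Y v = 0 := by
  constructor
  · rintro ⟨v, hv, hv0, h⟩
    refine ⟨⟨v, hv⟩, fun h0 => hv0 (congrArg Subtype.val h0), LinearMap.ext fun w => ?_⟩
    rw [kernelForm_apply, h w w.2, LinearMap.zero_apply]
  · rintro ⟨v, hv0, h⟩
    refine ⟨v, v.2, fun h0 => hv0 (Subtype.ext h0), fun w hw => ?_⟩
    rw [← M.kernelForm_apply Y v ⟨w, hw⟩, h, LinearMap.zero_apply]

theorem kernelForm_injective {M : SkGerm s n} {Y : Matrix (Fin n) (Fin n) ℂ}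
    (h : ¬ M.IsDegenerateAt Y) : Function.Injective (M.kernelForm Y) := by
  rw [injective_iff_map_eq_zero]
  intro v hv
  by_contra hv0
  exact h (isDegenerateAt_iff.2 ⟨v, hv0, hv⟩)

theorem isDegenerateAt_add_smul_iff {M : SkGerm s n} {Y Z : Matrix (Fin n) (Fin n) ℂ} {c : ℂ} :
    M.IsDegenerateAt (Y + c • Z) ↔ ∃ v ≠ 0, M.kernelForm Y v + c • M.kernelForm Z v = 0 := by
  rw [isDegenerateAt_iff]
  have h : ∀ v, M.kernelForm (Y + c • Z) v = M.kernelForm Y v + c • M.kernelForm Z v := fun v => by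
    refine LinearMap.ext fun w => ?_
    simp only [LinearMap.add_apply, LinearMap.smul_apply, kernelForm_apply, hess_add, hess_smul]
  simp only [h]

theorem finite_isDegenerateAt (M : SkGerm s n) (Y : Matrix (Fin n) (Fin n) ℂ)
    {Z : Matrix (Fin n) (Fin n) ℂ} (h : ¬ M.IsDegenerateAt Z) :
    {c : ℂ | M.IsDegenerateAt (Y + c • Z)}.Finite := by
  simp only [isDegenerateAt_add_smul_iff]
  exact finite_singular_pencil _ Subspace.dual_finrank_eq.symm (kernelForm_injective h)

theorem exists_isDegenerateAt {M : SkGerm s n} (Y : Matrix (Fin n) (Fin n) ℂ)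
    {Z : Matrix (Fin n) (Fin n) ℂ} (h : ¬ M.IsDegenerateAt Z)
    (hM : ∃ v ≠ 0, M.differential v = 0) : ∃ c : ℂ, M.IsDegenerateAt (Y + c • Z) := by
  obtain ⟨v, hv0, hv⟩ := hM
  have : Nontrivial (LinearMap.ker M.differential) := 
    ⟨⟨⟨v, hv⟩, 0, fun h0 => hv0 (congrArg Subtype.val h0)⟩⟩
  simp only [isDegenerateAt_add_smul_iff]
  exact exists_singular_pencil _ Subspace.dual_finrank_eq.symm (kernelForm_injective h)

theorem IsDegenerateAt.smul {M : SkGerm s n} {Y : Matrix (Fin n) (Fin n) ℂ}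
    (h : M.IsDegenerateAt Y) (k : ℂ) : M.IsDegenerateAt (k • Y) := by
  obtain ⟨v, hv, hv0, hw⟩ := h
  exact ⟨v, hv, hv0, fun w hw' => by simp [hess_smul, hw w hw']⟩

/-- Two bases are allowed because the invertible matrix `B` and the nondegenerate direction `Z` need
not coincide. Later `Z` is itself a singular matrix. -/
theorem crossRatios_finite {M : SkGerm s n} {A B Y Z : Matrix (Fin n) (Fin n) ℂ}
    (hAB : M.annihilator = Submodule.span ℂ {A, B}) (hB : B.det ≠ 0)
    (hYZ : M.annihilator = Submodule.span ℂ {Y, Z}) (hZ : ¬ M.IsDegenerateAt Z) :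
    M.crossRatios.Finite := by
  have h1 : CoveredByLines {X | X ∈ M.annihilator ∧ X.det = 0} := by
    refine coveredByLines_of_pencil (A := A) (B := B) (fun y hy => hAB ▸ hy.1)
      (fun y hy k _ => ⟨M.annihilator.smul_mem k hy.1, by simp [hy.2]⟩) (fun h => hB h.2)
      ((finite_det_add_smul_eq_zero A hB).subset fun c hc => hc.2)
  have h2 : CoveredByLines {X | X ∈ M.annihilator ∧ M.IsDegenerateAt X} := by
    refine coveredByLines_of_pencil (A := Y) (B := Z) (fun y hy => hYZ ▸ hy.1)
      (fun y hy k _ => ⟨M.annihilator.smul_mem k hy.1, hy.2.smul k⟩) (fun h => hZ h.2)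
      ((M.finite_isDegenerateAt Y hZ).subset fun c hc => hc.2)
  refine (finite_crossRatios h1 h2).subset ?_
  rintro c ⟨y, hy, z, hz, hli, dy, dz, dyz, hd⟩
  exact ⟨y, ⟨hy, dy⟩, z, ⟨hz, dz⟩, hli, ⟨add_mem hy hz, dyz⟩,
    add_mem hy (M.annihilator.smul_mem c hz), hd⟩

end SkGerm

/-! ### The Pfaffian. -/

/-- The Pfaffian of a skew-symmetric `6 × 6` matrix, in terms of the entries above the diagonal. -/
def pfaffianSix (Y : Matrix (Fin 6) (Fin 6) ℂ) : ℂ :=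
  Y 0 1 * (Y 2 3 * Y 4 5 - Y 2 4 * Y 3 5 + Y 2 5 * Y 3 4)
    - Y 0 2 * (Y 1 3 * Y 4 5 - Y 1 4 * Y 3 5 + Y 1 5 * Y 3 4)
    + Y 0 3 * (Y 1 2 * Y 4 5 - Y 1 4 * Y 2 5 + Y 1 5 * Y 2 4)
    - Y 0 4 * (Y 1 2 * Y 3 5 - Y 1 3 * Y 2 5 + Y 1 5 * Y 2 3)
    + Y 0 5 * (Y 1 2 * Y 3 4 - Y 1 3 * Y 2 4 + Y 1 4 * Y 2 3)

-- Singularity becomes a cubic condition instead of a sextic one; this is where three singular lines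
-- come from.
set_option maxHeartbeats 4000000 in
theorem det_eq_pfaffianSix_sq {Y : Matrix (Fin 6) (Fin 6) ℂ} (hY : Yᵀ = -Y) :
    Y.det = pfaffianSix Y ^ 2 := by
  have h : ∀ i j, Y j i = -Y i j := fun i j => congrFun (congrFun hY i) j
  have h0 : ∀ i, Y i i = 0 := fun i => by linear_combination (1 / 2 : ℂ) * h i i
  simp only [Matrix.det_succ_row_zero, Fin.sum_univ_succ, Matrix.submatrix_apply, Matrix.det_fin_zero, Fin.succAbove, Finset.univ_eq_empty, Finset.sum_empty]
  simp [Fin.succ, Fin.lt_def]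
  rw [pfaffianSix]
  simp only [h0, h 0 1, h 0 2, h 0 3, h 0 4, h 0 5, h 1 2, h 1 3, h 1 4, h 1 5, h 2 3, h 2 4, h 2 5,
    h 3 4, h 3 5, h 4 5]
  ring

/-! ### Derivatives of sums of squares of linear forms. -/

section SumOfSquares

variable {E ι : Type*} [NormedAddCommGroup E] [NormedSpace ℂ E] [Fintype ι]

theorem fderiv_fderiv_clm (l : E →L[ℂ] ℂ) (x : E) : fderiv ℂ (fderiv ℂ fun y => l y) x = 0 := by
  have : (fderiv ℂ fun y => l y) = fun _ => l := funext fun y => l.fderiv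
  rw [this, fderiv_fun_const]
  rfl

theorem analyticAt_sum_sq (c : ι → ℂ) (l : ι → E →L[ℂ] ℂ) (x : E) :
    AnalyticAt ℂ (fun y => ∑ i, c i * l i y ^ 2) x :=
  Finset.analyticAt_fun_sum _ fun i _ => analyticAt_const.mul (((l i).analyticAt x).pow 2)

theorem fderiv_sum_sq (c : ι → ℂ) (l : ι → E →L[ℂ] ℂ) :
    fderiv ℂ (fun y => ∑ i, c i * l i y ^ 2) 0 = 0 := by
  have h : ∀ i, HasFDerivAt (fun y => c i * l i y ^ 2) (0 : E →L[ℂ] ℂ) 0 := fun i => by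
    simp only [pow_two]
    exact (((l i).hasFDerivAt.mul (l i).hasFDerivAt).const_mul (c i)).congr_fderiv (by ext; simp)
  simpa using (HasFDerivAt.fun_sum fun i (_ : i ∈ Finset.univ) => h i).fderiv

theorem fderiv_fderiv_sum_sq (c : ι → ℂ) (l : ι → E →L[ℂ] ℂ) (v w : E) :
    fderiv ℂ (fderiv ℂ fun y => ∑ i, c i * l i y ^ 2) 0 v w = 2 * ∑ i, c i * (l i v * l i w) := by
  have hl : ∀ i, AnalyticAt ℂ (fun y => l i y) 0 := fun i => (l i).analyticAt 0
  have hl2 : ∀ i, AnalyticAt ℂ (fun y => c i * l i y ^ 2) 0 := fun i =>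
    analyticAt_const.mul ((hl i).pow 2)
  rw [fderiv_fderiv_sum _ fun i _ => hl2 i, Finset.mul_sum, _root_.sum_apply, _root_.sum_apply]
  refine Finset.sum_congr rfl fun i _ => ?_
  simp only [pow_two]
  have hll : AnalyticAt ℂ (fun y => l i y * l i y) 0 := (hl i).mul (hl i)
  rw [fderiv_fderiv_const_mul hll]
  have := fderiv_fderiv_mul_apply (hl i) (hl i) v w
  simp only [map_zero, zero_mul, zero_add, fderiv_fderiv_clm, (l i).fderiv] at this
  simp only [_root_.smul_apply, this, smul_eq_mul]
  ring

end SumOfSquares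

/-! ### Cross-ratios of the germs built from pairs of quadratic forms. -/

/-- The skew-symmetric matrix `𝓔_ij = E_ij - E_ji`. -/
def skewUnit {n : ℕ} (i j : Fin n) : Matrix (Fin n) (Fin n) ℂ :=
  Matrix.single i j 1 - Matrix.single j i 1

theorem skewUnit_transpose {n : ℕ} (i j : Fin n) : (skewUnit i j)ᵀ = -skewUnit i j := by
  simp [skewUnit]

/-- The linear map `L_a`. -/
noncomputable def genericRank13Linear : (Fin 13 → ℂ) →ₗ[ℂ] Matrix (Fin 6) (Fin 6) ℂ where
  toFun x := genericRank13Matrix x 0 0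
  map_add' x y := by
    ext i j
    fin_cases i <;> fin_cases j <;> simp [genericRank13Matrix] <;> ring
  map_smul' c x := by
    ext i j
    fin_cases i <;> fin_cases j <;> simp [genericRank13Matrix]

theorem genericRank13Matrix_eq (x : Fin 13 → ℂ) (p q : ℂ) :
    genericRank13Matrix x p q = genericRank13Linear x + p • skewUnit 0 3 + q • skewUnit 1 4 := by
  ext i j
  fin_cases i <;> fin_cases j <;>
    simp [genericRank13Matrix, genericRank13Linear, skewUnit] <;> ring

theorem genericRank13Linear_injective : Function.Injective genericRank13Linear := by
  rw [injective_iff_map_eq_zero]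
  intro x hx
  have h : ∀ i j, genericRank13Matrix x 0 0 i j = 0 := fun i j => congrFun (congrFun hx i) j
  have h1 := h 0 1
  have h2 := h 0 2
  have h3 := h 0 4
  have h4 := h 0 5
  have h5 := h 1 2
  have h6 := h 1 3
  have h7 := h 1 5
  have h8 := h 2 3
  have h9 := h 2 4
  have h10 := h 2 5
  have h11 := h 3 4
  have h12 := h 3 5
  have h13 := h 4 5
  simp [genericRank13Matrix] at *
  ext k
  fin_cases k <;> simp [*]

theorem tracePairing_genericRank13Linear {Y : Matrix (Fin 6) (Fin 6) ℂ} (hY : Yᵀ = -Y)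
    (x : Fin 13 → ℂ) : tracePairing 6 Y (genericRank13Linear x) =
      2 * (Y 0 1 * x 0 + Y 0 2 * x 1 + Y 0 4 * x 2 + Y 0 5 * x 3 + Y 1 2 * x 4 + Y 1 3 * x 5 +
        Y 1 5 * x 6 + Y 2 3 * x 7 + Y 2 4 * x 8 + (Y 2 5 - Y 0 3 - Y 1 4) * x 9 + Y 3 4 * x 10 +
        Y 3 5 * x 11 + Y 4 5 * x 12) := by
  have h : ∀ i j, Y j i = -Y i j := fun i j => congrFun (congrFun hY i) j
  rw [tracePairing_apply]
  simp only [genericRank13Linear, LinearMap.coe_mk, AddHom.coe_mk, genericRank13Matrix,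
    Fin.sum_univ_six]
  simp
  rw [h 0 1, h 0 2, h 0 3, h 0 4, h 0 5, h 1 2, h 1 3, h 1 4, h 1 5, h 2 3, h 2 4, h 2 5,
    h 3 4, h 3 5, h 4 5]
  ring

/-- Twelve of the coordinates kill one entry each. The coordinate `x 9`, which occurs in three
positions, gives `Y 2 5 = Y 0 3 + Y 1 4`. -/
theorem orthogonal_genericRank13Linear {Y : Matrix (Fin 6) (Fin 6) ℂ} :
    (Yᵀ = -Y ∧ ∀ x, tracePairing 6 Y (genericRank13Linear x) = 0) ↔
      ∃ a b : ℂ, Y = a • (skewUnit 0 3 + skewUnit 2 5) + b • (skewUnit 1 4 + skewUnit 2 5) := by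
  constructor
  · rintro ⟨hY, h⟩
    have hs : ∀ i j, Y j i = -Y i j := fun i j => congrFun (congrFun hY i) j
    have h0 : ∀ i, Y i i = 0 := fun i => by linear_combination (1 / 2 : ℂ) * hs i i
    have hk := fun k => (tracePairing_genericRank13Linear hY (Pi.single k 1)).symm.trans (h _)
    have h1 := hk 0
    have h2 := hk 1
    have h3 := hk 2
    have h4 := hk 3
    have h5 := hk 4
    have h6 := hk 5
    have h7 := hk 6
    have h8 := hk 7
    have h9 := hk 8
    have h10 := hk 9
    have h11 := hk 10
    have h12 := hk 11
    have h13 := hk 12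
    simp at h1 h2 h3 h4 h5 h6 h7 h8 h9 h10 h11 h12 h13
    have h10' : Y 2 5 = Y 0 3 + Y 1 4 := by linear_combination h10
    refine ⟨Y 0 3, Y 1 4, ?_⟩
    ext i j
    fin_cases i <;> fin_cases j <;>
      simp [skewUnit, h0, hs 0 1, hs 0 2, hs 0 3, hs 0 4, hs 0 5, hs 1 2,
        hs 1 3, hs 1 4, hs 1 5, hs 2 3, hs 2 4, hs 2 5, hs 3 4, hs 3 5, hs 4 5, h1, h2, h3, h4, h5,
        h6, h7, h8, h9, h10', h11, h12, h13]
    ring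
  · rintro ⟨a, b, rfl⟩
    have hY : (a • (skewUnit (0 : Fin 6) 3 + skewUnit 2 5) +
        b • (skewUnit 1 4 + skewUnit 2 5))ᵀ =
        -(a • (skewUnit (0 : Fin 6) 3 + skewUnit 2 5) + b • (skewUnit 1 4 + skewUnit 2 5)) := by
      simp only [Matrix.transpose_add, Matrix.transpose_smul, skewUnit_transpose]
      module
    refine ⟨hY, fun x => ?_⟩
    rw [tracePairing_genericRank13Linear hY]
    simp [skewUnit]

section quadraticPairGerm

open SkGerm

variable {m : ℕ} (a : Fin m → ℂ)

theorem quadraticPairGerm_toFun (w : Fin (13 + m) → ℂ) : (quadraticPairGerm a).toFun w =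
    genericRank13Linear (fun k => w (Fin.castAdd m k)) +
      (∑ i, (1 : ℂ) * w (Fin.natAdd 13 i) ^ 2) • skewUnit 0 3 +
      (∑ i, a i * w (Fin.natAdd 13 i) ^ 2) • skewUnit 1 4 := by
  rw [← genericRank13Matrix_eq]
  simp [quadraticPairGerm]

/-- The coordinates of `ℂ^13 × ℂ^m` on the second factor. -/
noncomputable def secondCoord (i : Fin m) : (Fin (13 + m) → ℂ) →L[ℂ] ℂ :=
  ContinuousLinearMap.proj (Fin.natAdd 13 i)

/-- The projection of `ℂ^13 × ℂ^m` to the first factor. -/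
def firstFactor (m : ℕ) : (Fin (13 + m) → ℂ) →ₗ[ℂ] (Fin 13 → ℂ) :=
  LinearMap.funLeft ℂ ℂ (Fin.castAdd m)

theorem quadraticPairGerm_entry (i j : Fin 6) :
    (fun w => (quadraticPairGerm a).toFun w i j) = fun w =>
      (LinearMap.toContinuousLinearMap (Matrix.entryLinearMap ℂ ℂ i j ∘ₗ genericRank13Linear ∘ₗ
        firstFactor m)) w +
      (skewUnit (0 : Fin 6) 3 i j * (∑ k, (1 : ℂ) * secondCoord k w ^ 2) +
      skewUnit (1 : Fin 6) 4 i j * (∑ k, a k * secondCoord k w ^ 2)) := by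
  ext w
  rw [quadraticPairGerm_toFun]
  simp only [Matrix.add_apply, Matrix.smul_apply, smul_eq_mul]
  rw [mul_comm, mul_comm (∑ i, a i * _), add_assoc]
  rfl

theorem differential_quadraticPairGerm :
    (quadraticPairGerm a).differential = genericRank13Linear ∘ₗ firstFactor m := by
  refine LinearMap.ext fun v => ?_
  ext i j
  have h := fun c : Fin m → ℂ => (analyticAt_sum_sq c secondCoord 0).differentiableAt
  rw [differential_apply, quadraticPairGerm_entry,
    fderiv_fun_add (ContinuousLinearMap.differentiableAt _)
      (((h _).const_mul _).fun_add ((h _).const_mul _)), ContinuousLinearMap.fderiv,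
    fderiv_fun_add ((h _).const_mul _) ((h _).const_mul _), fderiv_const_mul (h _),
    fderiv_const_mul (h _), fderiv_sum_sq, fderiv_sum_sq]
  simp

theorem second_quadraticPairGerm (v w : Fin (13 + m) → ℂ) :
    (quadraticPairGerm a).second v w =
      (2 * ∑ i, v (Fin.natAdd 13 i) * w (Fin.natAdd 13 i)) • skewUnit 0 3 +
      (2 * ∑ i, a i * (v (Fin.natAdd 13 i) * w (Fin.natAdd 13 i))) • skewUnit 1 4 := by
  ext i j
  have h := fun c : Fin m → ℂ => analyticAt_sum_sq c secondCoord 0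
  have h' : ∀ (t : ℂ) (c : Fin m → ℂ),
      AnalyticAt ℂ (fun y => t * ∑ i, c i * secondCoord i y ^ 2) 0 := fun t c =>
    analyticAt_const.mul (h c)
  have h'' : ∀ (t t' : ℂ) (c c' : Fin m → ℂ), AnalyticAt ℂ (fun y =>
      t * ∑ i, c i * secondCoord i y ^ 2 + t' * ∑ i, c' i * secondCoord i y ^ 2) 0 :=
    fun t t' c c' => (h' t c).add (h' t' c')
  rw [second_apply, quadraticPairGerm_entry,
    fderiv_fderiv_add (ContinuousLinearMap.analyticAt _ _) (h'' _ _ _ _), fderiv_fderiv_clm,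
    fderiv_fderiv_add (h' _ _) (h' _ _),
    fderiv_fderiv_const_mul (h _), fderiv_fderiv_const_mul (h _)]
  simp only [zero_add, _root_.add_apply, _root_.smul_apply, fderiv_fderiv_sum_sq]
  simp only [one_mul, Matrix.add_apply, Matrix.smul_apply, smul_eq_mul]
  rw [mul_comm, mul_comm (skewUnit (1 : Fin 6) 4 i j)]
  rfl

theorem firstFactor_surjective : Function.Surjective (firstFactor m) := fun x =>
  ⟨Fin.append x 0, funext fun k => by simp [firstFactor, LinearMap.funLeft_apply]⟩

theorem rank_quadraticPairGerm : (quadraticPairGerm a).rank = 13 := by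
  rw [SkGerm.rank, differential_quadraticPairGerm, LinearMap.range_comp_of_range_eq_top _
    (LinearMap.range_eq_top.2 firstFactor_surjective),
    LinearMap.finrank_range_of_inj genericRank13Linear_injective]
  simp

theorem mem_annihilator_quadraticPairGerm {Y : Matrix (Fin 6) (Fin 6) ℂ} :
    Y ∈ (quadraticPairGerm a).annihilator ↔
      ∃ p q : ℂ, Y = p • (skewUnit 0 3 + skewUnit 2 5) + q • (skewUnit 1 4 + skewUnit 2 5) := by
  rw [mem_annihilator, ← orthogonal_genericRank13Linear, differential_quadraticPairGerm]
  exact and_congr_right fun _ => ((firstFactor_surjective (m := m)).forall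
    (p := fun x => tracePairing 6 Y (genericRank13Linear x) = 0)).symm

theorem differential_quadraticPairGerm_eq_zero {v : Fin (13 + m) → ℂ} :
    (quadraticPairGerm a).differential v = 0 ↔ ∀ k, v (Fin.castAdd m k) = 0 := by
  rw [differential_quadraticPairGerm, LinearMap.comp_apply,
    map_eq_zero_iff _ genericRank13Linear_injective, funext_iff]
  rfl

/-- The factor 4 combines the 2 from differentiating a square with the 2 from pairing a skew unit
with itself. -/
theorem hess_quadraticPairGerm (p q : ℂ) (v w : Fin (13 + m) → ℂ) :
    (quadraticPairGerm a).hess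
      (p • (skewUnit 0 3 + skewUnit 2 5) + q • (skewUnit 1 4 + skewUnit 2 5)) v w =
      4 * ∑ i, (p + a i * q) * (v (Fin.natAdd 13 i) * w (Fin.natAdd 13 i)) := by
  have h1 : tracePairing 6 (skewUnit 0 3) (skewUnit 0 3) = 2 := by
    simp [tracePairing_apply, Fin.sum_univ_six, skewUnit, Matrix.single_apply]; norm_num
  have h2 : tracePairing 6 (skewUnit 1 4) (skewUnit 1 4) = 2 := by
    simp [tracePairing_apply, Fin.sum_univ_six, skewUnit, Matrix.single_apply]; norm_num
  have h3 : tracePairing 6 (skewUnit 0 3) (skewUnit 1 4) = 0 := by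
    simp [tracePairing_apply, Fin.sum_univ_six, skewUnit, Matrix.single_apply]
  have h4 : tracePairing 6 (skewUnit 1 4) (skewUnit 0 3) = 0 := by
    simp [tracePairing_apply, Fin.sum_univ_six, skewUnit, Matrix.single_apply]
  have h5 : tracePairing 6 (skewUnit 2 5) (skewUnit 0 3) = 0 := by
    simp [tracePairing_apply, Fin.sum_univ_six, skewUnit, Matrix.single_apply]
  have h6 : tracePairing 6 (skewUnit 2 5) (skewUnit 1 4) = 0 := by
    simp [tracePairing_apply, Fin.sum_univ_six, skewUnit, Matrix.single_apply]
  rw [hess_apply, second_quadraticPairGerm]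
  simp only [map_add, map_smul, LinearMap.add_apply, LinearMap.smul_apply, h1, h2, h3, h4, h5, h6,
    smul_eq_mul, add_mul, Finset.sum_add_distrib, mul_assoc, ← Finset.mul_sum]
  have : ∑ i, a i * (q * (v (Fin.natAdd 13 i) * w (Fin.natAdd 13 i))) =
      q * ∑ i, a i * (v (Fin.natAdd 13 i) * w (Fin.natAdd 13 i)) := by
    rw [Finset.mul_sum]
    exact Finset.sum_congr rfl fun i _ => by ring
  rw [this]
  ring

theorem crossRatios_quadraticPairGerm_finite : (quadraticPairGerm a).crossRatios.Finite := by
  refine crossRatios_finite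
    (A := skewUnit 0 3 + skewUnit 2 5)
    (B := (skewUnit 0 3 + skewUnit 2 5) + (skewUnit 1 4 + skewUnit 2 5))
    (Y := skewUnit 1 4 + skewUnit 2 5) (Z := skewUnit 0 3 + skewUnit 2 5) ?_ ?_ ?_ ?_
  · ext Y
    rw [mem_annihilator_quadraticPairGerm, Submodule.mem_span_pair]
    constructor
    · rintro ⟨p, q, rfl⟩
      exact ⟨p - q, q, by module⟩
    · rintro ⟨p, q, rfl⟩
      exact ⟨p + q, q, by module⟩
  -- `B` is the point `p = q = 1`, off the three lines `p = 0`, `q = 0`, `p + q = 0` where the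
  -- Pfaffian vanishes.
  · rw [det_eq_pfaffianSix_sq
      (by simp only [Matrix.transpose_add, skewUnit_transpose]; module)]
    simp [pfaffianSix, skewUnit]
  · ext Y
    rw [mem_annihilator_quadraticPairGerm, Submodule.mem_span_pair]
    constructor
    · rintro ⟨p, q, rfl⟩
      exact ⟨q, p, by module⟩
    · rintro ⟨p, q, rfl⟩
      exact ⟨q, p, by module⟩
  -- `Z` is the point `p = 1`, `q = 0`, whose form is four times the sum of squares on the kernel;
  -- basis vectors detect each coordinate.
  · rintro ⟨v, hv, hv0, hw⟩
    rw [differential_quadraticPairGerm_eq_zero] at hv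
    apply hv0
    have key : ∀ k, v (Fin.natAdd 13 k) = 0 := fun k => by
      have h1 := hw (Pi.single (Fin.natAdd 13 k) 1)
        ((differential_quadraticPairGerm_eq_zero a).2 fun l => by
          rw [Pi.single_apply, if_neg]
          intro h
          have := congrArg Fin.val h
          simp at this
          omega)
      have h2 := hess_quadraticPairGerm a 1 0 v (Pi.single (Fin.natAdd 13 k) 1)
      rw [one_smul, zero_smul, add_zero, h1] at h2
      simpa [Pi.single_apply] using h2.symm
    ext i
    exact Fin.addCases hv key i

/-- The basis `(p, q) = (1, 0), (0, -1)` is singular, and so is its sum `(1, -1)`. The point `(1,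
-c)` has the diagonal entry `1 - c a_l`, up to the factor 4, which vanishes at `c = 1 / a_l`. -/
theorem inv_mem_crossRatios_quadraticPairGerm {l : Fin m} (hl : a l ≠ 0) :
    (a l)⁻¹ ∈ (quadraticPairGerm a).crossRatios := by
  refine ⟨skewUnit 0 3 + skewUnit 2 5, (mem_annihilator_quadraticPairGerm a).2 ⟨1, 0, by module⟩,
    -(skewUnit 1 4 + skewUnit 2 5), (mem_annihilator_quadraticPairGerm a).2 ⟨0, -1, by module⟩,
    ?_, ?_, ?_, ?_, ?_⟩
  · rw [LinearIndependent.pair_iff]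
    intro p q h
    have h1 := congrFun (congrFun h 0) 3
    have h2 := congrFun (congrFun h 1) 4
    simp [skewUnit] at h1 h2
    exact ⟨h1, h2⟩
  · exact Matrix.det_eq_zero_of_row_eq_zero 1 fun j => by simp [skewUnit]
  · exact Matrix.det_eq_zero_of_row_eq_zero 0 fun j => by simp [skewUnit]
  · exact Matrix.det_eq_zero_of_row_eq_zero 2 fun j => by simp [skewUnit, Matrix.single_apply]
  · refine ⟨Pi.single (Fin.natAdd 13 l) 1, (differential_quadraticPairGerm_eq_zero a).2 fun k => ?_,
      by simp, fun w _ => ?_⟩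
    · rw [Pi.single_apply, if_neg]
      intro h
      have := congrArg Fin.val h
      simp at this
      omega
    · have h := hess_quadraticPairGerm a 1 (-(a l)⁻¹) (Pi.single (Fin.natAdd 13 l) 1) w
      rw [one_smul, neg_smul, ← smul_neg] at h
      rw [h]
      simp [Pi.single_apply, hl]

theorem finite_jetEquivalent_quadraticPairGerm :
    {b : Fin m → ℂ | JetEquivalent 2 (quadraticPairGerm a) (quadraticPairGerm b)}.Finite := by
  -- Adjoining 0 accounts for coordinates `b l = 0`, since `0⁻¹ = 0`.
  have hf : {z : ℂ | z⁻¹ ∈ insert 0 (quadraticPairGerm a).crossRatios}.Finite :=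
    ((crossRatios_quadraticPairGerm_finite a).insert 0).preimage inv_injective.injOn
  refine (Set.Finite.pi' fun _ : Fin m => hf).subset fun b hb l => ?_
  by_cases hl : b l = 0
  · simp [hl]
  · refine Or.inr ?_
    rw [JetEquivalent.crossRatios_eq hb]
    exact inv_mem_crossRatios_quadraticPairGerm b hl

end quadraticPairGerm

/-! ### Duality on the space of skew-symmetric matrices. -/

section SkewMatrices

variable {n : ℕ}

/-- The space of skew-symmetric matrices. -/
def skewMatrices (n : ℕ) : Submodule ℂ (Matrix (Fin n) (Fin n) ℂ) where
  carrier := {Y | Yᵀ = -Y}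
  add_mem' {a b} ha hb := by
    rw [Set.mem_ofPred_eq] at *
    rw [Matrix.transpose_add, ha, hb, neg_add]
  zero_mem' := by simp
  smul_mem' c a ha := by
    rw [Set.mem_ofPred_eq] at *
    rw [Matrix.transpose_smul, ha, smul_neg]

theorem mem_skewMatrices {Y : Matrix (Fin n) (Fin n) ℂ} : Y ∈ skewMatrices n ↔ Yᵀ = -Y := Iff.rfl

/-- A skew-symmetric matrix is determined by its entries above the diagonal. -/
def skewMatricesEquiv (n : ℕ) :
    skewMatrices n ≃ₗ[ℂ] ({p : Fin n × Fin n // p.1 < p.2} → ℂ) where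
  toFun Y p := Y.1 p.1.1 p.1.2
  map_add' _ _ := rfl
  map_smul' _ _ := rfl
  invFun g := ⟨Matrix.of fun i j => if h : i < j then g ⟨(i, j), h⟩ else
    if h : j < i then -g ⟨(j, i), h⟩ else 0, by
      rw [mem_skewMatrices]
      ext i j
      rcases lt_trichotomy i j with h | h | h <;> simp [h, h.not_gt]⟩
  left_inv Y := by
    have h : ∀ i j, Y.1 j i = -Y.1 i j := fun i j => congrFun (congrFun Y.2 i) j
    ext i j
    rcases lt_trichotomy i j with hij | rfl | hij
    · simp [hij]
    · have := h i i
      simp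
      linear_combination (-1 / 2 : ℂ) * this
    · simp [hij, hij.not_gt, h j i]
  right_inv g := by
    ext p
    simp [p.2]

theorem finrank_skewMatrices_six : Module.finrank ℂ (skewMatrices 6) = 15 := by
  rw [(skewMatricesEquiv 6).finrank_eq, Module.finrank_pi]
  decide

theorem tracePairing_comm (Y X : Matrix (Fin n) (Fin n) ℂ) :
    tracePairing n Y X = tracePairing n X Y := by
  simp only [tracePairing_apply, mul_comm]

-- Pairing a matrix with its complex conjugate gives the squared Frobenius norm.
open scoped ComplexOrder in
theorem tracePairing_star_self {Y : Matrix (Fin n) (Fin n) ℂ}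
    (h : tracePairing n Y (Y.map star) = 0) : Y = 0 := by
  have h1 : ((Y.map star)ᴴ * Y.map star).trace = 0 := by
    rw [← h, tracePairing_eq_trace]
    congr 2
    ext i j
    simp [Matrix.conjTranspose_apply]
  rw [Matrix.trace_conjTranspose_mul_self_eq_zero_iff] at h1
  ext i j
  simpa using congrFun (congrFun h1 i) j

theorem map_star_skew {Y : Matrix (Fin n) (Fin n) ℂ} (hY : Yᵀ = -Y) :
    (Y.map star)ᵀ = -Y.map star := by
  rw [← Matrix.transpose_map, hY]
  ext i j
  simp

/-- Gram–Schmidt for the Hermitian form: `D` is the part of `Y` orthogonal to `Z`, and `X` is its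
conjugate, suitably scaled. -/
theorem exists_dual_skew {Y Z : Matrix (Fin n) (Fin n) ℂ} (hY : Yᵀ = -Y) (hZ : Zᵀ = -Z)
    (h : LinearIndependent ℂ ![Y, Z]) :
    ∃ X : Matrix (Fin n) (Fin n) ℂ, Xᵀ = -X ∧ tracePairing n Y X = 1 ∧ tracePairing n Z X = 0 := by
  have hZ0 : tracePairing n Z (Z.map star) ≠ 0 := fun h0 =>
    h.ne_zero 1 (tracePairing_star_self h0)
  rw [LinearIndependent.pair_iff] at h
  set t := tracePairing n Z (Y.map star) / tracePairing n Z (Z.map star) with ht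
  set D := Y + (-star t) • Z with hD
  have hD0 : D ≠ 0 := fun h0 => one_ne_zero (h 1 (-star t) (by rw [one_smul]; exact h0)).1
  have hDs : D.map star = Y.map star - t • Z.map star := by
    ext i j
    simp [hD, sub_eq_add_neg]
  have hDt : Dᵀ = -D := by
    rw [hD, Matrix.transpose_add, Matrix.transpose_smul, hY, hZ]
    module
  have hZD : tracePairing n Z (D.map star) = 0 := by
    rw [hDs, map_sub, map_smul, smul_eq_mul, ht, div_mul_cancel₀ _ hZ0, sub_self]
  have hYD : tracePairing n Y (D.map star) ≠ 0 := fun h0 => hD0 (tracePairing_star_self (by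
    rw [hD, map_add, map_smul, LinearMap.add_apply, LinearMap.smul_apply, ← hD, h0, hZD,
      smul_zero, add_zero]))
  refine ⟨(tracePairing n Y (D.map star))⁻¹ • D.map star, ?_, ?_, ?_⟩
  · rw [Matrix.transpose_smul, map_star_skew hDt, smul_neg]
  · rw [map_smul, smul_eq_mul, inv_mul_cancel₀ hYD]
  · rw [map_smul, hZD, smul_zero]

/-- The trace pairing on skew-symmetric matrices. -/
noncomputable def skewPairing (n : ℕ) : LinearMap.BilinForm ℂ (skewMatrices n) :=
  (tracePairing n).restrict (skewMatrices n)

theorem skewPairing_apply (X Y : skewMatrices n) :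
    skewPairing n X Y = tracePairing n X Y := rfl

theorem skewPairing_nondegenerate (n : ℕ) : (skewPairing n).Nondegenerate := by
  have h : ∀ X : skewMatrices n, (∀ Y, skewPairing n X Y = 0) → X = 0 := fun X hX =>
    Subtype.ext (tracePairing_star_self (hX ⟨_, map_star_skew X.2⟩))
  refine ⟨h, fun X hX => h X fun Y => ?_⟩
  rw [skewPairing_apply, tracePairing_comm]
  exact hX Y

end SkewMatrices

namespace SkGerm

variable {s n : ℕ}

theorem differential_skew (M : SkGerm s n) (v : Fin s → ℂ) :
    M.differential v ∈ skewMatrices n := by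
  rw [mem_skewMatrices]
  ext i j
  have h : (fun x => M.toFun x j i) =ᶠ[𝓝 0] fun x => -M.toFun x i j := by
    filter_upwards [M.skew] with x hx
    exact congrFun (congrFun hx i) j
  rw [Matrix.transpose_apply, Matrix.neg_apply, differential_apply, differential_apply,
    h.fderiv_eq, fderiv_fun_neg]
  rfl

/-- The differential takes skew values, so the annihilator is the orthogonal complement of its range
for a nondegenerate form on skew matrices. -/
theorem finrank_annihilator (M : SkGerm s n) :
    Module.finrank ℂ M.annihilator = Module.finrank ℂ (skewMatrices n) - M.rank := by
  set W : Submodule ℂ (skewMatrices n) :=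
    (LinearMap.range M.differential).comap (skewMatrices n).subtype with hW
  have hrange : LinearMap.range M.differential ≤ skewMatrices n := by
    rintro _ ⟨v, rfl⟩
    exact M.differential_skew v
  have h1 : Module.finrank ℂ W = M.rank :=
    (Submodule.comapSubtypeEquivOfLe hrange).finrank_eq
  have h2 : M.annihilator = ((skewPairing n).orthogonal W).map (skewMatrices n).subtype := by
    ext Y
    rw [Submodule.mem_map]
    constructor
    · rintro ⟨hY, h⟩
      refine ⟨⟨Y, hY⟩, ?_, rfl⟩
      rintro X ⟨v, hv⟩
      have hv' : M.differential v = X := hv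
      change skewPairing n _ _ = 0
      rw [skewPairing_apply, ← hv', tracePairing_comm]
      exact h v
    · rintro ⟨X, hX, rfl⟩
      refine ⟨X.2, fun v => ?_⟩
      rw [tracePairing_comm]
      exact hX ⟨M.differential v, M.differential_skew v⟩ ⟨v, rfl⟩
  rw [h2, Submodule.finrank_map_subtype_eq,
    LinearMap.BilinForm.finrank_orthogonal (skewPairing_nondegenerate n), h1]

theorem exists_annihilator_basis {M : SkGerm s 6} (h : M.rank = 13) :
    ∃ Y Z, LinearIndependent ℂ ![Y, Z] ∧ M.annihilator = Submodule.span ℂ {Y, Z} := by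
  have h2 : Module.finrank ℂ M.annihilator = 2 := by
    rw [finrank_annihilator, finrank_skewMatrices_six, h]
  let b := Module.finBasisOfFinrankEq ℂ M.annihilator h2
  refine ⟨b 0, b 1, ?_, ?_⟩
  · have := b.linearIndependent.map' M.annihilator.subtype (Submodule.ker_subtype _)
    have he : ![(b 0 : Matrix (Fin 6) (Fin 6) ℂ), b 1] = M.annihilator.subtype ∘ b :=
      funext fun i => by fin_cases i <;> rfl
    rwa [he]
  · ext Y
    rw [Submodule.mem_span_pair]
    constructor
    · intro hY
      refine ⟨b.repr ⟨Y, hY⟩ 0, b.repr ⟨Y, hY⟩ 1, ?_⟩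
      have := congrArg Subtype.val (b.sum_repr ⟨Y, hY⟩)
      rw [Fin.sum_univ_two] at this
      exact this
    · rintro ⟨p, q, rfl⟩
      exact add_mem (M.annihilator.smul_mem _ (b 0).2) (M.annihilator.smul_mem _ (b 1).2)

theorem exists_ne_zero_differential_eq_zero {M : SkGerm s n} (h : M.rank < s) :
    ∃ v ≠ 0, M.differential v = 0 := by
  by_contra! hc
  have hi : Function.Injective M.differential := by
    rw [injective_iff_map_eq_zero]
    exact fun v hv => by_contra fun h0 => hc v h0 hv
  have := LinearMap.finrank_range_of_inj hi
  rw [rank, this] at h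
  simp at h

end SkGerm

/-! ### Generic pencils: three distinct singular lines. -/

section PfaffianCubic

/-- The cubic polynomial `t ↦ Pf (Y + t Z)`. -/
noncomputable def pfaffianCubic (Y Z : Matrix (Fin 6) (Fin 6) ℂ) : Cubic ℂ where
  a := pfaffianSix Z
  b := (pfaffianSix (Y + Z) + pfaffianSix (Y - Z)) / 2 - pfaffianSix Y
  c := (pfaffianSix (Y + Z) - pfaffianSix (Y - Z)) / 2 - pfaffianSix Z
  d := pfaffianSix Y

/-- The middle coefficients are interpolated from the values at `t = 1` and `t = -1`. -/
theorem pfaffianSix_add_smul (Y Z : Matrix (Fin 6) (Fin 6) ℂ) (t : ℂ) :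
    pfaffianSix (Y + t • Z) = (pfaffianCubic Y Z).a * t ^ 3 + (pfaffianCubic Y Z).b * t ^ 2 +
      (pfaffianCubic Y Z).c * t + (pfaffianCubic Y Z).d := by
  simp only [pfaffianCubic, pfaffianSix, Matrix.add_apply, Matrix.sub_apply, Matrix.smul_apply,
    smul_eq_mul]
  ring

/-- Nonvanishing of this number means that `Z` is regular and that the pencil has three distinct
singular lines. -/
noncomputable def pencilDiscr (Y Z : Matrix (Fin 6) (Fin 6) ℂ) : ℂ :=
  (pfaffianCubic Y Z).a * (pfaffianCubic Y Z).discr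

theorem exists_singular_triple {Y Z : Matrix (Fin 6) (Fin 6) ℂ} (hY : Yᵀ = -Y) (hZ : Zᵀ = -Z)
    (hli : LinearIndependent ℂ ![Y, Z]) (hD : pencilDiscr Y Z ≠ 0) :
    ∃ A B, LinearIndependent ℂ ![A, B] ∧ Submodule.span ℂ {A, B} = Submodule.span ℂ {Y, Z} ∧
      A.det = 0 ∧ B.det = 0 ∧ (A + B).det = 0 := by
  obtain ⟨ha, hdisc⟩ := mul_ne_zero_iff.1 hD
  obtain ⟨x, y, z, hr⟩ := (Cubic.splits_iff_roots_eq_three (φ := RingHom.id ℂ) ha).1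
    (IsAlgClosed.splits _)
  obtain ⟨hxy, hxz, hyz⟩ := (Cubic.discr_ne_zero_iff_roots_ne ha hr).1 hdisc
  rw [show Cubic.map (RingHom.id ℂ) (pfaffianCubic Y Z) = pfaffianCubic Y Z from rfl] at hr
  have hdet : ∀ t ∈ (pfaffianCubic Y Z).roots, (Y + t • Z).det = 0 := fun t ht => by
    rw [Cubic.mem_roots_iff (Cubic.ne_zero_of_a_ne_zero ha)] at ht
    rw [det_eq_pfaffianSix_sq, pfaffianSix_add_smul, ht, zero_pow two_ne_zero]
    rw [Matrix.transpose_add, Matrix.transpose_smul, hY, hZ]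
    module
  have hx := hdet x (by simp [hr])
  have hy := hdet y (by simp [hr])
  have hz := hdet z (by simp [hr])
  have exy := sub_ne_zero.2 hxy
  have exz := sub_ne_zero.2 hxz
  have eyz := sub_ne_zero.2 hyz
  -- This linear relation among three points of the pencil dictates the scaling that makes the sum
  -- of the first two singular vectors lie on the third line.
  have hsum : (z - y) • (Y + x • Z) + (x - z) • (Y + y • Z) = (x - y) • (Y + z • Z) := by module
  refine ⟨(z - y) • (Y + x • Z), (x - z) • (Y + y • Z), ?_, ?_, ?_, ?_, ?_⟩
  · rw [LinearIndependent.pair_iff] at hli ⊢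
    intro p q hpq
    obtain ⟨h1, h2⟩ := hli (p * (z - y) + q * (x - z)) (p * (z - y) * x + q * (x - z) * y)
      (by rw [← hpq]; module)
    have h3 : p * (y - z) * (x - y) = 0 := by linear_combination y * h1 - h2
    have h4 : q * (x - z) * (x - y) = 0 := by linear_combination x * h1 - h2
    simp [exy, exz, eyz] at h3 h4
    exact ⟨h3, h4⟩
  · ext X
    simp only [Submodule.mem_span_pair]
    constructor
    · rintro ⟨p, q, rfl⟩
      exact ⟨p * (z - y) + q * (x - z), p * (z - y) * x + q * (x - z) * y, by module⟩
    · rintro ⟨p, q, rfl⟩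
      refine ⟨(p * y - q) / ((y - z) * (x - y)), (p * x - q) / ((x - z) * (x - y)), ?_⟩
      match_scalars
      · field_simp
        ring
      · field_simp
        ring
  · rw [Matrix.det_smul, hx, mul_zero]
  · rw [Matrix.det_smul, hy, mul_zero]
  · rw [hsum, Matrix.det_smul, hz, mul_zero]

theorem differentiable_pfaffianSix {γ : ℂ → Matrix (Fin 6) (Fin 6) ℂ}
    (h : ∀ i j, Differentiable ℂ fun t => γ t i j) :
    Differentiable ℂ fun t => pfaffianSix (γ t) := by
  have h' := fun i j => h i j
  unfold pfaffianSix
  fun_prop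

theorem differentiable_pencilDiscr (Y H Z K : Matrix (Fin 6) (Fin 6) ℂ) :
    Differentiable ℂ fun t : ℂ => pencilDiscr (Y + t • H) (Z + t • K) := by
  have h1 : Differentiable ℂ fun t : ℂ => pfaffianSix (Y + t • H) :=
    differentiable_pfaffianSix fun i j => by
      simp only [Matrix.add_apply, Matrix.smul_apply, smul_eq_mul]; fun_prop
  have h2 : Differentiable ℂ fun t : ℂ => pfaffianSix (Z + t • K) :=
    differentiable_pfaffianSix fun i j => by
      simp only [Matrix.add_apply, Matrix.smul_apply, smul_eq_mul]; fun_prop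
  have h3 : Differentiable ℂ fun t : ℂ => pfaffianSix (Y + t • H + (Z + t • K)) :=
    differentiable_pfaffianSix fun i j => by
      simp only [Matrix.add_apply, Matrix.smul_apply, smul_eq_mul]; fun_prop
  have h4 : Differentiable ℂ fun t : ℂ => pfaffianSix (Y + t • H - (Z + t • K)) :=
    differentiable_pfaffianSix fun i j => by
      simp only [Matrix.add_apply, Matrix.sub_apply, Matrix.smul_apply, smul_eq_mul]; fun_prop
  simp only [pencilDiscr, pfaffianCubic, Cubic.discr]
  fun_prop

/-- Identity theorem: an entire function of `t` that is nonzero at `t = 1` cannot vanish at points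
accumulating at 0. -/
theorem eventually_pencilDiscr_ne_zero {Y H Z K : Matrix (Fin 6) (Fin 6) ℂ}
    (h : pencilDiscr (Y + H) (Z + K) ≠ 0) :
    ∀ᶠ t : ℂ in 𝓝[≠] 0, pencilDiscr (Y + t • H) (Z + t • K) ≠ 0 := by
  by_contra hc
  rw [Filter.not_eventually] at hc
  have := AnalyticOnNhd.eq_of_frequently_eq
    ((differentiable_pencilDiscr Y H Z K).differentiableOn.analyticOnNhd isOpen_univ)
    (g := fun _ => 0) analyticOnNhd_const (hc.mono fun t ht => not_not.1 ht)
  exact h (by simpa using congrFun this 1)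

theorem exists_pencilDiscr_ne_zero : ∃ F G : Matrix (Fin 6) (Fin 6) ℂ,
    Fᵀ = -F ∧ Gᵀ = -G ∧ pencilDiscr F G ≠ 0 := by
  -- Here `Pf (F + t G) = -t (t + 1) (t - 1)`.
  refine ⟨skewUnit 1 4 - skewUnit 2 5, skewUnit 0 3 + skewUnit 1 4 + skewUnit 2 5, ?_, ?_, ?_⟩
  · rw [Matrix.transpose_sub, skewUnit_transpose, skewUnit_transpose]
    module
  · simp only [Matrix.transpose_add, skewUnit_transpose]
    module
  · simp [pencilDiscr, pfaffianCubic, Cubic.discr, pfaffianSix, skewUnit]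

end PfaffianCubic

/-! ### Perturbations of germs and their effect on the invariants. -/

namespace SkGerm

variable {s n : ℕ}

/-- The germ `M + c f X`, for a scalar germ `f` and a constant skew-symmetric matrix `X`. -/
def perturb (M : SkGerm s n) {f : (Fin s → ℂ) → ℂ} (hf : AnalyticAt ℂ f 0) (hf0 : f 0 = 0)
    {X : Matrix (Fin n) (Fin n) ℂ} (hX : Xᵀ = -X) (c : ℂ) : SkGerm s n where
  toFun x := M.toFun x + (c * f x) • X
  analytic i j := (M.analytic i j).add ((analyticAt_const.mul hf).mul analyticAt_const)
  skew := by
    filter_upwards [M.skew] with x hx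
    rw [Matrix.transpose_add, Matrix.transpose_smul, hx, hX, smul_neg, neg_add]
  map_zero := by rw [M.map_zero, hf0, mul_zero, zero_smul, add_zero]

variable (M : SkGerm s n) {f : (Fin s → ℂ) → ℂ} (hf : AnalyticAt ℂ f 0) (hf0 : f 0 = 0)
  {X : Matrix (Fin n) (Fin n) ℂ} (hX : Xᵀ = -X) (c : ℂ)

theorem perturb_entry (i j : Fin n) : (fun x => (M.perturb hf hf0 hX c).toFun x i j) =
    fun x => M.toFun x i j + c * X i j * f x := by
  ext x
  simp only [perturb, Matrix.add_apply, Matrix.smul_apply, smul_eq_mul]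
  ring

theorem differential_perturb (v : Fin s → ℂ) : (M.perturb hf hf0 hX c).differential v =
    M.differential v + (c * fderiv ℂ f 0 v) • X := by
  ext i j
  rw [differential_apply, perturb_entry, fderiv_fun_add (M.analytic i j).differentiableAt
    (hf.differentiableAt.const_mul _), fderiv_const_mul hf.differentiableAt]
  simp only [_root_.add_apply, _root_.smul_apply, Matrix.add_apply, Matrix.smul_apply, smul_eq_mul,
    differential_apply]
  ring

theorem second_perturb (v w : Fin s → ℂ) : (M.perturb hf hf0 hX c).second v w =
    M.second v w + (c * fderiv ℂ (fderiv ℂ f) 0 v w) • X := by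
  ext i j
  have h : ∀ t : ℂ, AnalyticAt ℂ (fun x => t * f x) 0 := fun t => analyticAt_const.mul hf
  rw [second_apply, perturb_entry, fderiv_fderiv_add (M.analytic i j) (h _),
    fderiv_fderiv_const_mul hf]
  simp only [_root_.add_apply, _root_.smul_apply, Matrix.add_apply, Matrix.smul_apply, smul_eq_mul,
    second_apply]
  ring

theorem hess_perturb (Y : Matrix (Fin n) (Fin n) ℂ) (v w : Fin s → ℂ) :
    (M.perturb hf hf0 hX c).hess Y v w =
      M.hess Y v w + c * fderiv ℂ (fderiv ℂ f) 0 v w * tracePairing n Y X := by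
  rw [hess_apply, second_perturb, map_add, map_smul, smul_eq_mul, hess_apply]

theorem continuous_jet_perturb (k : ℕ) :
    Continuous fun c => (M.perturb hf hf0 hX c).jet k := by
  refine continuous_pi fun i => continuous_pi fun j => continuous_pi fun l => ?_
  have h : ∀ c, (M.perturb hf hf0 hX c).jet k i j l =
      iteratedFDeriv ℂ l (fun x => M.toFun x i j) 0 + (c * X i j) • iteratedFDeriv ℂ l f 0 := by
    intro c
    have h' : ∀ t : ℂ, ContDiffAt ℂ (l : ℕ) (t • f) 0 := fun t => hf.contDiffAt.const_smul t
    rw [jet, perturb_entry,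
      show (fun x => M.toFun x i j + c * X i j * f x) =
        (fun x => M.toFun x i j) + (c * X i j) • f from rfl,
      iteratedFDeriv_add_apply (M.analytic i j).contDiffAt (h' _),
      iteratedFDeriv_const_smul_apply hf.contDiffAt]
  simp only [h]
  fun_prop

theorem jet_perturb_zero (k : ℕ) : (M.perturb hf hf0 hX 0).jet k = M.jet k := by
  have h : ∀ i j, (fun x => (M.perturb hf hf0 hX 0).toFun x i j) = fun x => M.toFun x i j :=
    fun i j => by simp [perturb_entry]
  funext i j l
  simp only [jet, h]

theorem tendsto_jet_perturb (k : ℕ) :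
    Tendsto (fun c => (M.perturb hf hf0 hX c).jet k) (𝓝 0) (𝓝 (M.jet k)) := by
  have := (M.continuous_jet_perturb hf hf0 hX k).tendsto 0
  rwa [jet_perturb_zero] at this

theorem differential_perturb_of_fderiv_eq_zero (hd : fderiv ℂ f 0 = 0) :
    (M.perturb hf hf0 hX c).differential = M.differential := by
  refine LinearMap.ext fun v => ?_
  rw [differential_perturb, hd, _root_.zero_apply, mul_zero, zero_smul, add_zero]

theorem annihilator_perturb_of_fderiv_eq_zero (hd : fderiv ℂ f 0 = 0) :
    (M.perturb hf hf0 hX c).annihilator = M.annihilator := by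
  ext Y
  rw [mem_annihilator, mem_annihilator, differential_perturb_of_fderiv_eq_zero _ _ _ _ _ hd]

theorem component_zero (Y : Matrix (Fin n) (Fin n) ℂ) : M.component Y 0 = 0 := by
  rw [component, M.map_zero, _root_.map_zero]

variable {M}

/-- The differential is composed with `P = id - (1 + ⟨H, X⟩)⁻¹ ⟨H, ·⟩ X`, so `W` annihilates the new
range when its image under the adjoint of `P` annihilates the old one. The constant is chosen so
that this adjoint sends `Y + H` to `Y`; it fixes `Z` because `⟨Z, X⟩ = 0`. -/
theorem annihilator_perturb_component {Y Z H : Matrix (Fin n) (Fin n) ℂ} (hH : Hᵀ = -H)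
    (hM : M.annihilator = Submodule.span ℂ {Y, Z})
    (hYX : tracePairing n Y X = 1) (hZX : tracePairing n Z X = 0)
    (hHX : 1 + tracePairing n H X ≠ 0) :
    (M.perturb (M.analyticAt_component H) (M.component_zero H) hX
      (-(1 + tracePairing n H X)⁻¹)).annihilator = Submodule.span ℂ {Y + H, Z} := by
  have hY : Y ∈ M.annihilator := hM ▸ Submodule.subset_span (by simp)
  have hZ : Z ∈ M.annihilator := hM ▸ Submodule.subset_span (by simp)
  set h := tracePairing n H X with hh
  have key : ∀ W v, tracePairing n W ((M.perturb (M.analyticAt_component H) (M.component_zero H) hX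
      (-(1 + h)⁻¹)).differential v) = tracePairing n (W - ((1 + h)⁻¹ * tracePairing n W X) • H)
        (M.differential v) := fun W v => by
    rw [differential_perturb, fderiv_component, map_add, map_smul, map_sub, map_smul,
      LinearMap.sub_apply, LinearMap.smul_apply, smul_eq_mul, smul_eq_mul]
    ring
  ext W
  rw [mem_annihilator, Submodule.mem_span_pair]
  simp only [key]
  constructor
  · rintro ⟨hW, hv⟩
    have hmem : W - ((1 + h)⁻¹ * tracePairing n W X) • H ∈ M.annihilator :=
      ⟨by rw [Matrix.transpose_sub, Matrix.transpose_smul, hW, hH]; module, hv⟩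
    rw [hM, Submodule.mem_span_pair] at hmem
    obtain ⟨a, b, hab⟩ := hmem
    have hp := congrArg (fun W => tracePairing n W X) hab
    simp only [map_add, map_sub, map_smul, LinearMap.add_apply, LinearMap.sub_apply,
      LinearMap.smul_apply, hYX, hZX, smul_eq_mul, ← hh] at hp
    have ha : a = (1 + h)⁻¹ * tracePairing n W X := by
      field_simp at hp ⊢
      linear_combination hp
    refine ⟨a, b, ?_⟩
    rw [← ha] at hab
    rw [smul_add]
    linear_combination (norm := module) hab
  · rintro ⟨a, b, rfl⟩
    have e : a • (Y + H) + b • Z -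
        ((1 + h)⁻¹ * tracePairing n (a • (Y + H) + b • Z) X) • H = a • Y + b • Z := by
      simp only [map_add, map_smul, LinearMap.add_apply, LinearMap.smul_apply, hYX, hZX,
        smul_eq_mul, ← hh]
      rw [show (1 + h)⁻¹ * (a * (1 + h) + b * 0) = a by field_simp; ring]
      module
    rw [e]
    refine ⟨?_, fun v => ?_⟩
    · simp only [Matrix.transpose_add, Matrix.transpose_smul, hY.1, hZ.1, hH]
      module
    · rw [map_add, map_smul, map_smul, LinearMap.add_apply, LinearMap.smul_apply,
        LinearMap.smul_apply, hY.2, hZ.2, smul_zero, smul_zero, add_zero]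

theorem eventually_exists_annihilator_eq {Y Z H : Matrix (Fin n) (Fin n) ℂ} (hH : Hᵀ = -H)
    (hli : LinearIndependent ℂ ![Y, Z]) (hM : M.annihilator = Submodule.span ℂ {Y, Z})
    (hker : ∃ v ≠ 0, M.differential v = 0) {U : Set _} (hU : IsOpen U) (hMU : M.jet 2 ∈ U) :
    ∀ᶠ t : ℂ in 𝓝 0, ∃ N : SkGerm s n, N.jet 2 ∈ U ∧ LinearIndependent ℂ ![Y + t • H, Z] ∧
      N.annihilator = Submodule.span ℂ {Y + t • H, Z} ∧ ∃ v ≠ 0, N.differential v = 0 := by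
  have hY : Y ∈ M.annihilator := hM ▸ Submodule.subset_span (by simp)
  have hZ : Z ∈ M.annihilator := hM ▸ Submodule.subset_span (by simp)
  obtain ⟨X, hX, hYX, hZX⟩ := exists_dual_skew hY.1 hZ.1 hli
  have hcont : ContinuousAt (fun t : ℂ => 1 + t * tracePairing n H X) 0 := by fun_prop
  have hne : ∀ᶠ t : ℂ in 𝓝 0, 1 + t * tracePairing n H X ≠ 0 :=
    hcont.eventually_ne (by simp)
  -- By linearity in `H`, perturbing with `t • H` is perturbing with `H` and this small coefficient,
  -- so the jet stays in `U`.
  have hc : Tendsto (fun t : ℂ => -(1 + t * tracePairing n H X)⁻¹ * t) (𝓝 0) (𝓝 0) := by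
    have h1 : ContinuousAt (fun t : ℂ => -(1 + t * tracePairing n H X)⁻¹ * t) 0 :=
      ((hcont.inv₀ (by simp)).neg).mul continuousAt_id
    simpa using h1.tendsto
  have hjet := ((M.tendsto_jet_perturb (M.analyticAt_component H) (M.component_zero H) hX 2).comp
    hc).eventually (hU.mem_nhds hMU)
  filter_upwards [hne, hjet] with t ht hjt
  have htH : (t • H)ᵀ = -(t • H) := by rw [Matrix.transpose_smul, hH, smul_neg]
  have htX : tracePairing n (t • H) X = t * tracePairing n H X := by
    rw [map_smul, LinearMap.smul_apply, smul_eq_mul]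
  have hcomp : ∀ x, M.component (t • H) x = t * M.component H x := fun x => by
    rw [component, map_smul, LinearMap.smul_apply, smul_eq_mul, component]
  refine ⟨M.perturb (M.analyticAt_component (t • H)) (M.component_zero (t • H)) hX
    (-(1 + tracePairing n (t • H) X)⁻¹), ?_, ?_,
    annihilator_perturb_component hX htH hM hYX hZX (by rwa [htX]), ?_⟩
  · convert hjt using 1
    have : M.perturb (M.analyticAt_component (t • H)) (M.component_zero (t • H)) hX
        (-(1 + tracePairing n (t • H) X)⁻¹) =
        M.perturb (M.analyticAt_component H) (M.component_zero H) hX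
        (-(1 + t * tracePairing n H X)⁻¹ * t) := by
      simp only [perturb, hcomp, htX, mul_assoc]
    rw [this]
    rfl
  · have hZ0 := hli.ne_zero 1
    rw [LinearIndependent.pair_iff]
    intro p q hpq
    have hp := congrArg (fun W => tracePairing n W X) hpq
    simp only [map_add, map_smul, LinearMap.add_apply, LinearMap.smul_apply, hYX, hZX, smul_eq_mul,
      mul_zero, add_zero, _root_.map_zero, LinearMap.zero_apply] at hp
    have hp0 : p = 0 := (mul_eq_zero.1 hp).resolve_right ht
    subst hp0
    rw [zero_smul, zero_add] at hpq
    exact ⟨rfl, (smul_eq_zero.1 hpq).resolve_right hZ0⟩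
  · obtain ⟨v, hv0, hv⟩ := hker
    refine ⟨v, hv0, ?_⟩
    rw [differential_perturb, fderiv_component, hv, _root_.map_zero, mul_zero, zero_smul, add_zero]

/-- The two generators are moved one at a time, slightly, along the lines towards a pencil `F, G`
known to be generic: first `Y` with the second argument held at `G`, then `Z`. -/
theorem exists_generic_annihilator {M : SkGerm s 6} (hs : 13 < s) (hM : M.rank = 13)
    {U : Set _} (hU : IsOpen U) (hMU : M.jet 2 ∈ U) :
    ∃ N : SkGerm s 6, N.jet 2 ∈ U ∧ (∃ v ≠ 0, N.differential v = 0) ∧ ∃ Y Z,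
      LinearIndependent ℂ ![Y, Z] ∧ N.annihilator = Submodule.span ℂ {Y, Z} ∧
      pencilDiscr Y Z ≠ 0 := by
  obtain ⟨F, G, hF, hG, hFG⟩ := exists_pencilDiscr_ne_zero
  obtain ⟨Y, Z, hli, hYZ⟩ := exists_annihilator_basis hM
  have hY : Y ∈ M.annihilator := hYZ ▸ Submodule.subset_span (by simp)
  have hZ : Z ∈ M.annihilator := hYZ ▸ Submodule.subset_span (by simp)
  have hker := exists_ne_zero_differential_eq_zero (M := M) (by omega)
  have h1 : ∀ᶠ t : ℂ in 𝓝[≠] 0, pencilDiscr (Y + t • (F - Y)) G ≠ 0 := by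
    have := eventually_pencilDiscr_ne_zero (Y := Y) (H := F - Y) (Z := G) (K := 0)
      (by rwa [add_sub_cancel, add_zero])
    simpa using this
  have hFY : (F - Y)ᵀ = -(F - Y) := by rw [Matrix.transpose_sub, hF, hY.1]; module
  have hGZ : (G - Z)ᵀ = -(G - Z) := by rw [Matrix.transpose_sub, hG, hZ.1]; module
  obtain ⟨t, ⟨N, hNU, hNli, hN, hNker⟩, ht⟩ := (((eventually_exists_annihilator_eq hFY hli hYZ hker
    hU hMU).filter_mono nhdsWithin_le_nhds).and h1).exists
  set Y' := Y + t • (F - Y) with hY'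
  have h2 : ∀ᶠ u : ℂ in 𝓝[≠] 0, pencilDiscr Y' (Z + u • (G - Z)) ≠ 0 := by
    have := eventually_pencilDiscr_ne_zero (Y := Y') (H := 0) (Z := Z) (K := G - Z)
      (by rwa [add_sub_cancel, add_zero])
    simpa using this
  obtain ⟨u, ⟨P, hPU, hPli, hP, hPker⟩, hu⟩ := (((eventually_exists_annihilator_eq hGZ
    (LinearIndependent.pair_symm_iff.1 hNli) (by rwa [Set.pair_comm]) hNker
    hU hNU).filter_mono nhdsWithin_le_nhds).and h2).exists
  exact ⟨P, hPU, hPker, _, _, LinearIndependent.pair_symm_iff.1 hPli, by rwa [Set.pair_comm], hu⟩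

/-- A sum of squares which is nondegenerate on a given subspace. -/
theorem exists_sum_sq_nondegenerate (K : Submodule ℂ (Fin s → ℂ)) :
    ∃ f : (Fin s → ℂ) → ℂ, AnalyticAt ℂ f 0 ∧ f 0 = 0 ∧ fderiv ℂ f 0 = 0 ∧
      ∀ v ∈ K, (∀ w ∈ K, fderiv ℂ (fderiv ℂ f) 0 v w = 0) → v = 0 := by
  let b := Module.finBasis ℂ K
  choose g hg using fun i => LinearMap.exists_extend (b.coord i)
  let l := fun i => LinearMap.toContinuousLinearMap (g i)
  have hl : ∀ i (v : K), l i v = b.coord i v := fun i v => DFunLike.congr_fun (hg i) v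
  refine ⟨fun x => ∑ i, 1 * l i x ^ 2, analyticAt_sum_sq _ l 0, by simp,
    fderiv_sum_sq (fun _ => 1) l, fun v hv h => ?_⟩
  have h0 : (⟨v, hv⟩ : K) = 0 := b.ext_elem fun k => by
    have h1 := h (b k) (b k).2
    rw [fderiv_fderiv_sum_sq (fun _ => 1) l] at h1
    have h2 := fun i => hl i ⟨v, hv⟩
    simp only at h2
    simp only [h2, hl] at h1
    simpa [Finsupp.single_apply] using h1
  exact congrArg Subtype.val h0

/-- The form at `Z` changes by `c` times a nondegenerate form, so it can be degenerate for only
finitely many `c`. -/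
theorem eventually_not_isDegenerateAt_perturb {Z : Matrix (Fin n) (Fin n) ℂ}
    (hd : fderiv ℂ f 0 = 0) (hZX : tracePairing n Z X = 1)
    (hnd : ∀ v, M.differential v = 0 →
      (∀ w, M.differential w = 0 → fderiv ℂ (fderiv ℂ f) 0 v w = 0) → v = 0) :
    ∀ᶠ c in 𝓝[≠] 0, ¬ (M.perturb hf hf0 hX c).IsDegenerateAt Z := by
  let g : LinearMap.ker M.differential →ₗ[ℂ] Module.Dual ℂ (LinearMap.ker M.differential) :=
    LinearMap.mk₂ ℂ (fun v w => fderiv ℂ (fderiv ℂ f) 0 v w) (fun _ _ _ => by simp)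
      (fun _ _ _ => by simp) (fun _ _ _ => by simp) (fun _ _ _ => by simp)
  have hg : Function.Injective g := by
    rw [injective_iff_map_eq_zero]
    intro v hv
    exact Subtype.ext (hnd v v.2 fun w hw => DFunLike.congr_fun hv ⟨w, hw⟩)
  have hfin := finite_singular_pencil (M.kernelForm Z) Subspace.dual_finrank_eq.symm hg
  refine (nhdsNE_le_cofinite 0) ?_
  rw [← Filter.Eventually, Filter.eventually_cofinite]
  refine hfin.subset fun c hc => ?_
  obtain ⟨v, hv, hv0, h⟩ := not_not.1 hc
  rw [differential_perturb_of_fderiv_eq_zero _ _ _ _ _ hd] at hv h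
  refine ⟨⟨v, hv⟩, fun h0 => hv0 (congrArg Subtype.val h0), LinearMap.ext fun w => ?_⟩
  have := h w w.2
  rw [hess_perturb, hZX, mul_one] at this
  exact this

/-- The added term changes the Hessian at `Y` by `-u` times the Hessian at `Z` and leaves the one at
`Z` alone. The degenerate parameter therefore moves from `t` to `t + u`, while the differential, and
with it the annihilator, is untouched. -/
theorem isDegenerateAt_perturb_component {Y Z : Matrix (Fin n) (Fin n) ℂ}
    (hZ : Z ∈ M.annihilator) (hYX : tracePairing n Y X = 1) (hZX : tracePairing n Z X = 0)
    (u t : ℂ) :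
    (M.perturb (M.analyticAt_component Z) (M.component_zero Z) hX (-u)).IsDegenerateAt
      (Y + (t + u) • Z) ↔ M.IsDegenerateAt (Y + t • Z) := by
  have e : ∀ v w, (M.perturb (M.analyticAt_component Z) (M.component_zero Z) hX (-u)).hess
      (Y + (t + u) • Z) v w = M.hess (Y + t • Z) v w := fun v w => by
    rw [hess_perturb, fderiv_fderiv_component]
    simp only [map_add, map_smul, LinearMap.add_apply, LinearMap.smul_apply, hYX, hZX, hess_add,
      hess_smul, smul_eq_mul]
    ring
  simp only [IsDegenerateAt, differential_perturb_of_fderiv_eq_zero _ _ _ _ _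
    (fderiv_component_eq_zero hZ), e]

theorem not_isDegenerateAt_perturb_component {Z : Matrix (Fin n) (Fin n) ℂ}
    (hZ : Z ∈ M.annihilator) (hZX : tracePairing n Z X = 0) (hnd : ¬ M.IsDegenerateAt Z) (u : ℂ) :
    ¬ (M.perturb (M.analyticAt_component Z) (M.component_zero Z) hX (-u)).IsDegenerateAt Z := by
  simpa only [IsDegenerateAt, differential_perturb_of_fderiv_eq_zero _ _ _ _ _
    (fderiv_component_eq_zero hZ), hess_perturb, hZX, mul_zero, add_zero] using hnd

/-! ### Moduli in rank 13. -/

/-- Near a germ of rank `13` there is a curve of germs along which a cross-ratio varies. -/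
theorem exists_varying_crossRatios {M : SkGerm s 6} (hs : 13 < s) (hM : M.rank = 13)
    {U : Set _} (hU : IsOpen U) (hMU : M.jet 2 ∈ U) :
    ∃ t : ℂ, ∀ᶠ u in 𝓝 (0 : ℂ), ∃ N : SkGerm s 6, N.jet 2 ∈ U ∧ N.crossRatios.Finite ∧
      t + u ∈ N.crossRatios := by
  obtain ⟨N, hNU, hker, Y, Z, hli, hYZ, hD⟩ := exists_generic_annihilator hs hM hU hMU
  have hY : Y ∈ N.annihilator := hYZ ▸ Submodule.subset_span (by simp)
  have hZ : Z ∈ N.annihilator := hYZ ▸ Submodule.subset_span (by simp)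
  have hdet : Z.det ≠ 0 := by
    rw [det_eq_pfaffianSix_sq hZ.1]
    exact pow_ne_zero 2 (mul_ne_zero_iff.1 hD).1
  obtain ⟨A, B, hAB, hspan, dA, dB, dAB⟩ := exists_singular_triple hY.1 hZ.1 hli hD
  have hA : A ∈ N.annihilator := by rw [hYZ, ← hspan]; exact Submodule.subset_span (by simp)
  have hB : B ∈ N.annihilator := by rw [hYZ, ← hspan]; exact Submodule.subset_span (by simp)
  -- `X` will translate the cross-ratio; `X'` serves to make the form at `B` nondegenerate.
  obtain ⟨X, hX, hAX, hBX⟩ := exists_dual_skew hA.1 hB.1 hAB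
  obtain ⟨X', hX', hBX', -⟩ := exists_dual_skew hB.1 hA.1 (LinearIndependent.pair_symm_iff.1 hAB)
  obtain ⟨f, hf, hf0, hd, hnd⟩ := exists_sum_sq_nondegenerate (LinearMap.ker N.differential)
  obtain ⟨c, hc, hcU⟩ := ((eventually_not_isDegenerateAt_perturb hf hf0 hX' hd hBX' hnd).and
    (((N.tendsto_jet_perturb hf hf0 hX' 2).eventually (hU.mem_nhds hNU)).filter_mono
      nhdsWithin_le_nhds)).exists
  have hPa := N.annihilator_perturb_of_fderiv_eq_zero hf hf0 hX' c hd
  have hPd := N.differential_perturb_of_fderiv_eq_zero hf hf0 hX' c hd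
  set P := N.perturb hf hf0 hX' c with hP
  obtain ⟨t, ht⟩ := exists_isDegenerateAt A hc (by rwa [hPd])
  have hBP : B ∈ P.annihilator := by rwa [hPa]
  have hneg : Tendsto (fun u : ℂ => -u) (𝓝 0) (𝓝 0) := by simpa using continuous_neg.tendsto (0 : ℂ)
  refine ⟨t, ?_⟩
  filter_upwards [((P.tendsto_jet_perturb (P.analyticAt_component B) (P.component_zero B) hX 2).comp
    hneg).eventually (hU.mem_nhds hcU)] with u hu
  have hQa := P.annihilator_perturb_of_fderiv_eq_zero (P.analyticAt_component B)
    (P.component_zero B) hX (-u) (fderiv_component_eq_zero hBP)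
  rw [hPa] at hQa
  -- The invertible matrix comes from the basis `Y, Z` and the nondegenerate form from `A, B`, since
  -- `B` itself is singular.
  refine ⟨_, hu, crossRatios_finite (hQa.trans hYZ) hdet (hQa.trans (hYZ.trans hspan.symm))
    (not_isDegenerateAt_perturb_component hX hBP hBX hc u), A, ?_, B, ?_, hAB, dA, dB, dAB,
    (isDegenerateAt_perturb_component hX hBP hAX hBX u t).2 ht⟩
  · rwa [hQa]
  · rwa [hQa]

theorem not_isJetSimple_two {M : SkGerm s 6} (hs : 13 < s) (hM : M.rank = 13) :
    ¬ M.IsJetSimple 2 := by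
  rintro ⟨U, hU, T, hT, h⟩
  obtain ⟨V, hVU, hV, hMV⟩ := mem_nhds_iff.1 hU
  obtain ⟨t, ht⟩ := exists_varying_crossRatios hs hM hV hMV
  -- Representatives with infinitely many cross-ratios are discarded: the germs on the curve have
  -- finite sets, and so do the representatives of their orbits.
  have hfin : (⋃ P ∈ {P ∈ T | P.crossRatios.Finite}, P.crossRatios).Finite :=
    (hT.subset fun P hP => hP.1).biUnion fun P hP => hP.2
  have hfin' := hfin.preimage (add_right_injective t).injOn
  refine (infinite_of_mem_nhds (0 : ℂ) ?_) hfin'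
  filter_upwards [ht] with u hu
  obtain ⟨N, hNV, hN, htu⟩ := hu
  obtain ⟨P, hPT, hNP⟩ := h N (hVU hNV)
  rw [hNP.crossRatios_eq] at hN htu
  exact Set.mem_biUnion (⟨hPT, hN⟩ : P ∈ {P ∈ T | P.crossRatios.Finite}) htu

end SkGerm

theorem mainTheorem10 :
    (∀ s : ℕ, 13 < s → ∀ M : SkGerm s 6, M.rank = 13 → ¬ M.IsSimple ∧ ¬ M.IsJetSimple 2) ∧
    (∀ (m : ℕ) (a : Fin m → ℂ), (quadraticPairGerm a).rank = 13 ∧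
      {b : Fin m → ℂ |
        SkGerm.JetEquivalent 2 (quadraticPairGerm a) (quadraticPairGerm b)}.Finite) :=
  ⟨fun _ hs _ hM => ⟨fun h => SkGerm.not_isJetSimple_two hs hM (h 2),
    SkGerm.not_isJetSimple_two hs hM⟩, fun _ a => ⟨rank_quadraticPairGerm a,
    finite_jetEquivalent_quadraticPairGerm a⟩⟩
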